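/- An instance of Budgeted Submodular Maximization (BSM) consists of a finite ground set $V$, a non-negative, monotone, submodular function $f\colon 2^V\to\mathbb{R}_{\ge 0}$, costs $c(v)>0$ for $v\in V$, and a budget $B>0$ with $c(v)\le B$ for all $v \in V$; one maximizes $f(S)$ over the feasible sets, i.e. the sets $S\subseteq V$ with $c(S)=\sum_{v\in S}c(v)\le B$. Let $n=|V|\geq 1$, and let $OPT$ be an optimal solution. An algorithm admits an approximation ratio $\rho$ if it always outputs a feasible $T$ with $f(T)\ge\rho f(OPT)$. Greedy$^+$ starts with $S_0=\varnothing$ and, as long as some $v\notin S_i$ satisfies $c(S_i\cup\{v\})\le B$, sets $S_{i+1}=S_i\cup\{v\}$ for such a $v$ of maximum density $(f(S_i\cup\{v\})-f(S_i))/c(v)$; if it stops after $\ell$ iterations, it returns a set of maximum value among $S_\ell$ and all sets $S_i\cup\{v\}$ with $0\le i<\ell$, $v\in V$ and $c(S_i\cup\{v\})\le B$. 1-Guess Greedy$^+$ executes, for every $y\in V$ with $c(y)\leq B$, Greedy$^+$ on the residual instance with ground set $V\setminus\{y\}$, objective $S\mapsto f(S\cup\{y\})-f(\{y\})$ and budget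 $B-c(y)$, adds $y$ to the output, and returns the best of the sets so obtained and $\varnothing$. Time is counted in elementary steps, where an evaluation of $f$ on a given set, a real arithmetic operation or comparison, and a basic list operation take one step each. **Theorem.** (1) For every way of breaking ties, 1-Guess Greedy$^+$ admits an approximation ratio of $$\rho=\frac{3-\ln 4}{4-\ln 4}>0.6174>0.9767\,(1-1/e).$$ (2) 1-Guess Greedy$^+$ can be implemented to run in $O(n^3)$ time. (3) There is a variant of 1-Guess Greedy$^+$ using decreasing density thresholds (an element is added when it fits in the budget and its density is at least the current threshold, instead of choosing an element of maximum density) which, for every $\varepsilon\in(0,1)$, admits an approximation ratio of $(1-\varepsilon)\rho$ and runs in $\tilde O(n^2/\varepsilon)$ time, that is, in at most $C\,\frac{n^2}{\varepsilon}\,(1+\ln(n/\varepsilon))^k$ steps, with constants $C$ and $k$ that do not depend on the instance or on $\varepsilon$. -/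

import Mathlib

namespace BSM

/-! ### The problem -/

/-- The data of an instance of budgeted maximization: a finite ground set, a set function, element
costs and a budget. -/
structure Inst (V : Type) where
  ground : Finset V
  f : Finset V → ℝ
  c : V → ℝ
  B : ℝ

variable {V : Type} [DecidableEq V]

/-- The cost of a set of elements. -/
def Inst.cost (I : Inst V) (S : Finset V) : ℝ := ∑ v ∈ S, I.c v

/-- The feasible solutions: sets of elements whose cost is within the budget. -/
def Inst.Feasible (I : Inst V) (S : Finset V) : Prop := S ⊆ I.ground ∧ I.cost S ≤ I.B

/-- An instance of Budgeted Submodular Maximization: the objective is non-negative, monotone and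
submodular, costs and budget are positive, and every single element fits in the budget. -/
structure Inst.IsBSM (I : Inst V) : Prop where
  nonneg : ∀ S ⊆ I.ground, 0 ≤ I.f S
  mono : ∀ S T : Finset V, S ⊆ T → T ⊆ I.ground → I.f S ≤ I.f T
  submod : ∀ S ⊆ I.ground, ∀ u ∈ I.ground, ∀ v ∈ I.ground, u ∉ S → v ∉ S → u ≠ v →
    I.f (insert u (insert v S)) - I.f (insert v S) ≤ I.f (insert u S) - I.f S
  cost_pos : ∀ v ∈ I.ground, 0 < I.c v
  budget_pos : 0 < I.B
  cost_le : ∀ v ∈ I.ground, I.c v ≤ I.B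

/-- `T` is a feasible solution whose value is at least `ρ` times that of every feasible solution. -/
def Inst.IsApprox (I : Inst V) (ρ : ℝ) (T : Finset V) : Prop :=
  I.Feasible T ∧ ∀ S : Finset V, I.Feasible S → ρ * I.f S ≤ I.f T

/-! ### The algorithms, as nondeterministic procedures (ties are broken arbitrarily) -/

/-- `T` is a member of the family `𝒮` maximizing `f`. -/
def IsBest (f : Finset V → ℝ) (𝒮 : Set (Finset V)) (T : Finset V) : Prop :=
  T ∈ 𝒮 ∧ ∀ T' ∈ 𝒮, f T' ≤ f T

/-- `v` can be added to `S` within the budget. -/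
def Inst.CanAdd (I : Inst V) (S : Finset V) (v : V) : Prop :=
  v ∈ I.ground ∧ v ∉ S ∧ I.cost (insert v S) ≤ I.B

/-- The density of `v` with respect to `S`. -/
noncomputable def Inst.density (I : Inst V) (S : Finset V) (v : V) : ℝ :=
  (I.f (insert v S) - I.f S) / I.c v

/-- One iteration of Plain Greedy: add an element of maximum density among those that fit. -/
def Inst.GreedyStep (I : Inst V) (S S' : Finset V) : Prop :=
  ∃ v, I.CanAdd S v ∧ (∀ u, I.CanAdd S u → I.density S u ≤ I.density S v) ∧ S' = insert v S

/-- `S 0, …, S ℓ` are the successive solutions of a complete run of Plain Greedy. -/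
def Inst.IsGreedyRun (I : Inst V) (ℓ : ℕ) (S : ℕ → Finset V) : Prop :=
  S 0 = ∅ ∧ (∀ i < ℓ, I.GreedyStep (S i) (S (i + 1))) ∧ ∀ v, ¬ I.CanAdd (S ℓ) v

/-- The possible outputs of Greedy⁺: a best set among the final solution of Plain Greedy and all
feasible augmentations of its earlier solutions by one element. -/
def greedyPlus (I : Inst V) : Set (Finset V) :=
  {T | ∃ (ℓ : ℕ) (S : ℕ → Finset V), I.IsGreedyRun ℓ S ∧
    IsBest I.f ({S ℓ} ∪ {T' | ∃ i < ℓ, ∃ v ∈ I.ground,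
      I.cost (insert v (S i)) ≤ I.B ∧ T' = insert v (S i)}) T}

/-- The residual instance after the elements of `Y` have been taken. -/
def Inst.residual (I : Inst V) (Y : Finset V) : Inst V where
  ground := I.ground \ Y
  f := fun S => I.f (S ∪ Y) - I.f Y
  c := I.c
  B := I.B - I.cost Y

/-- The possible outputs of `k`-Guess `ALG`; here `ALG J` is the set of the possible outputs of
`ALG` on the instance `J`, and `A Y` is the output of its execution for the guess `Y`. -/
def guess (k : ℕ) (ALG : Inst V → Set (Finset V)) (I : Inst V) : Set (Finset V) :=
  {T | ∃ A : Finset V → Finset V,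
    (∀ Y, I.Feasible Y → Y.card = k → A Y ∈ ALG (I.residual Y)) ∧
    IsBest I.f ({T' | ∃ Y, I.Feasible Y ∧ Y.card = k ∧ T' = A Y ∪ Y} ∪
      {T' | I.Feasible T' ∧ T'.card < k}) T}

/-! ### Implementations with a step count

The cost model is the usual one: a real arithmetic operation, a comparison, the lookup of a cost, an
evaluation of the objective on a given set, an assignment, and a basic operation on a linked list
(attaching a new head to an existing list, returning a list) take one step each. Reading the head of a
list or branching on a computed result always goes together with at least one charged step. A solution
is kept as a linked list of its elements, and all loops are written out as recursions over such lists. -/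

/-- A result together with the number of elementary steps spent on obtaining it. -/
structure Timed (α : Type) where
  val : α
  time : ℕ

instance : Monad Timed where
  pure a := ⟨a, 0⟩
  bind x g := ⟨(g x.val).val, x.time + (g x.val).time⟩

/-- An elementary operation with result `a`: one step. -/
def op {α : Type} (a : α) : Timed α := ⟨a, 1⟩

/-- Removing an element from a list. -/
def remove (v : V) : List V → Timed (List V)
  | [] => op []
  | u :: R => do
    let same ← op (decide (u = v))
    if same then op R
    else do
      let R' ← remove v R
      op (u :: R')

/-- The length of a list. -/
def len {α : Type} : List α → Timed ℕ
  | [] => op 0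
  | _ :: R => do
    let k ← len R
    op (k + 1)

/-- Oracle call: the value of the objective on the set listed in `S`. -/
def eval (I : Inst V) (S : List V) : Timed ℝ := op (I.f S.toFinset)

/-- Record the solution `S` of value `a` if it is at least as good as the incumbent `b`. -/
noncomputable def record (b : ℝ × List V) (a : ℝ) (S : List V) : Timed (ℝ × List V) := do
  let better ← op (decide (b.1 ≤ a))
  if better then op (a, S) else op b

/-- Compare the element `v` of density `d`, leading to value `a`, with the densest element so far. -/
noncomputable def denser (p : Option (ℝ × V × ℝ)) (d : ℝ) (v : V) (a : ℝ) :
    Timed (Option (ℝ × V × ℝ)) :=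
  match p with
  | none => op (some (d, v, a))
  | some q => do
    let better ← op (decide (q.1 < d))
    if better then op (some (d, v, a)) else op p

/-- Scan the elements outside the current solution `S` (of cost `κ` and value `a`): find a densest
element `p` that fits, and record in `b` every feasible augmentation of `S`. -/
noncomputable def scan (I : Inst V) (S : List V) (κ a : ℝ) :
    List V → Option (ℝ × V × ℝ) → ℝ × List V → Timed (Option (ℝ × V × ℝ) × (ℝ × List V))
  | [], p, b => op (p, b)
  | v :: R, p, b => do
    let cv ← op (I.c v)
    let κ' ← op (κ + cv)
    let fits ← op (decide (κ' ≤ I.B))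
    if fits then do
      let S' ← op (v :: S)
      let a' ← eval I S'
      let m ← op (a' - a)
      let d ← op (m / cv)
      let p' ← denser p d v a'
      let b' ← record b a' S'
      scan I S κ a R p' b'
    else scan I S κ a R p b

/-- The main loop of Greedy⁺ from the solution `S` (of cost `κ` and value `a`), where `R` lists the
elements outside `S` and `b` is the best recorded solution. The first argument bounds the number of
iterations; the number of elements outside `S` is always enough. -/
noncomputable def greedyLoop (I : Inst V) :
    ℕ → List V → List V → ℝ → ℝ → ℝ × List V → Timed (ℝ × List V)
  | 0, _, _, _, _, b => op b
  | k + 1, R, S, κ, a, b => do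
    let r ← scan I S κ a R none b
    match r.1 with
    | none => op r.2
    | some q => do
      let R' ← remove q.2.1 R
      let S' ← op (q.2.1 :: S)
      let cv ← op (I.c q.2.1)
      let κ' ← op (κ + cv)
      greedyLoop I k R' S' κ' q.2.2 r.2

/-- The loop over the guesses: the second list holds the guesses still to be tried, `l` the whole
ground set, and `b` the best solution so far. -/
noncomputable def guessLoop (I : Inst V) (l : List V) : List V → ℝ × List V → Timed (ℝ × List V)
  | [], b => op b
  | y :: G, b => do
    let cy ← op (I.c y)
    let fits ← op (decide (cy ≤ I.B))
    if fits then do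
      let fy ← eval I [y]
      let R ← remove y l
      let k ← len R
      let s ← greedyLoop I k R [y] cy fy (fy, [y])
      let b' ← record b s.1 s.2
      guessLoop I l G b'
    else guessLoop I l G b

/-- 1-Guess Greedy⁺ on the instance `I` whose ground set is listed in `l`. -/
noncomputable def oneGuessGreedyPlus (I : Inst V) (l : List V) : Timed (List V) := do
  let e ← eval I []
  let b ← guessLoop I l l (e, [])
  op b.2

/-! ### The variant with thresholding

Every element `v` with `f {v} > 0` gets the decreasing density thresholds
`(f {v} / c v) * (1 - δ) ^ j`, `j = 0, 1, …`, until they drop to a `δ / n` fraction of the first.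
For a guess, the pairs (threshold, element) are visited in decreasing order of the thresholds, and an
element is added to the solution when it fits and its density is at least the threshold visited.
Augmentations by single elements are examined only when the value of the solution has grown
substantially since they were last examined. -/

/-- Insert a pair into a list of pairs that is decreasing in the threshold. -/
noncomputable def insertDesc (x : ℝ × V) : List (ℝ × V) → Timed (List (ℝ × V))
  | [] => op [x]
  | y :: E => do
    let before ← op (decide (y.1 ≤ x.1))
    if before then op (x :: y :: E)
    else do
      let E' ← insertDesc x E
      op (y :: E')

/-- The largest value of a single element, and the list, decreasing in the threshold, of the pairs
`(f {v} / c v, v)` with `f {v} > 0`. -/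
noncomputable def firstThresholds (I : Inst V) : List V → Timed (ℝ × List (ℝ × V))
  | [] => op (0, [])
  | v :: R => do
    let r ← firstThresholds I R
    let a ← eval I [v]
    let larger ← op (decide (r.1 ≤ a))
    let M ← op (if larger then a else r.1)
    let pos ← op (decide (0 < a))
    if pos then do
      let cv ← op (I.c v)
      let θ ← op (a / cv)
      let E ← insertDesc (θ, v) r.2
      op (M, E)
    else op (M, r.2)

/-- Multiply all thresholds by `q`. -/
noncomputable def scale (q : ℝ) : List (ℝ × V) → Timed (List (ℝ × V))
  | [] => op []
  | x :: E => do
    let θ ← op (q * x.1)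
    let E' ← scale q E
    op ((θ, x.2) :: E')

/-- Merge two lists that are decreasing in the threshold. -/
noncomputable def merge : List (ℝ × V) → List (ℝ × V) → Timed (List (ℝ × V))
  | [], E => op E
  | E, [] => op E
  | x :: E, y :: E' => do
    let before ← op (decide (y.1 ≤ x.1))
    if before then do
      let E'' ← merge E (y :: E')
      op (x :: E'')
    else do
      let E'' ← merge (x :: E) E'
      op (y :: E'')
termination_by E E' => E.length + E'.length

/-- Double the number of thresholds of each element until the factor `q` between the first and the
next new threshold is at most `t`. The first argument bounds the number of rounds. -/
noncomputable def allThresholds (t : ℝ) : ℕ → ℝ → List (ℝ × V) → Timed (List (ℝ × V))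
  | 0, _, E => op E
  | k + 1, q, E => do
    let stop' ← op (decide (q ≤ t))
    if stop' then op E
    else do
      let E' ← scale q E
      let E'' ← merge E E'
      let q' ← op (q * q)
      allThresholds t k q' E''

/-- Record in `b` every feasible augmentation of the solution `S` (of cost `κ`). -/
noncomputable def augment (I : Inst V) (S : List V) (κ : ℝ) :
    List V → ℝ × List V → Timed (ℝ × List V)
  | [], b => op b
  | v :: R, b => do
    let cv ← op (I.c v)
    let κ' ← op (κ + cv)
    let fits ← op (decide (κ' ≤ I.B))
    if fits then do
      let S' ← op (v :: S)
      let a' ← eval I S'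
      let b' ← record b a' S'
      augment I S κ R b'
    else augment I S κ R b

/-- Visit the pairs (threshold, element) in order. The current solution `S` has cost `κ` and value
`a`; `z` was the value of the solution when augmentations were last examined. -/
noncomputable def thresholdLoop (I : Inst V) (l : List V) (δ M : ℝ) :
    List (ℝ × V) → List V → ℝ → ℝ → ℝ → ℝ × List V → Timed (ℝ × List V)
  | [], _, _, _, _, b => op b
  | x :: E, S, κ, a, z, b => do
    let cv ← op (I.c x.2)
    let κ' ← op (κ + cv)
    let fits ← op (decide (κ' ≤ I.B))
    if fits then do
      let S' ← op (x.2 :: S)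
      let a' ← eval I S'
      let m ← op (a' - a)
      let t ← op (x.1 * cv)
      let dense ← op (decide (t ≤ m))
      if dense then do
        let b' ← record b a' S'
        let s ← op (z + M)
        let u ← op (δ * s)
        let z' ← op (z + u)
        let grown ← op (decide (z' < a'))
        if grown then do
          let b'' ← augment I S' κ' l b'
          thresholdLoop I l δ M E S' κ' a' a' b''
        else thresholdLoop I l δ M E S' κ' a' z b'
      else thresholdLoop I l δ M E S κ a z b
    else thresholdLoop I l δ M E S κ a z b

/-- The loop over the guesses. -/
noncomputable def thresholdGuessLoop (I : Inst V) (l : List V) (δ M : ℝ) (E : List (ℝ × V)) :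
    List V → ℝ × List V → Timed (ℝ × List V)
  | [], b => op b
  | y :: G, b => do
    let cy ← op (I.c y)
    let fits ← op (decide (cy ≤ I.B))
    if fits then do
      let fy ← eval I [y]
      let b₀ ← augment I [y] cy l (fy, [y])
      let s ← thresholdLoop I l δ M E [y] cy fy fy b₀
      let b' ← record b s.1 s.2
      thresholdGuessLoop I l δ M E G b'
    else thresholdGuessLoop I l δ M E G b

/-- 1-Guess Greedy⁺ with thresholding, with accuracy parameter `ε`, on the instance `I` whose ground
set is listed in `l`. (The bound `⌈n / δ ^ 2⌉₊` on the number of doubling rounds is never reached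
before the loop stops by itself; it only makes the recursion terminate formally.) -/
noncomputable def oneGuessGreedyPlusThreshold (I : Inst V) (l : List V) (ε : ℝ) :
    Timed (List V) := do
  let e ← eval I []
  let n ← len l
  let δ ← op (ε / 16)
  let r ← firstThresholds I l
  let t ← op (δ / n)
  let q ← op (1 - δ)
  let E ← allThresholds t ⌈(n : ℝ) / δ ^ 2⌉₊ q r.2
  let b ← thresholdGuessLoop I l δ r.1 E l (e, [])
  op b.2

end BSM

/-! Let `O` be a feasible set with at least two elements, `y` an element of `O` of largest value `f
{y}`, and `r` an element of largest cost in `O \ {y}` (`Inst.IsSplit`). Only the guess `y` matters.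
Write `F = f O`, `g = gap`, and suppose that all sets examined for this guess have value below `(1 -
g) F`. While `r` fits, so does every missing element of `O`. The rest `T = O \ {y, r}` then has
total marginal value at least `F - f (S ∪ {r})`, which is at least `g F`, because `S ∪ {r}` has been
examined, and at least `F - f {y} - f S`, because `f {r} ≤ f {y}`. In multiples of `g F` this is at
least `max u 1`, where `u` is `Inst.missing`. As `T` costs at most `X = B - c y - c r`
(`Inst.room`), adding a densest `v` lowers `u` by at least `(c v / X) * max u 1`.

The concave function `tlog` has derivative `1 / max u 1`, so such a step lowers `tlog u` by at least
`c v / X` (`tlog_missing_step`). Once `r` no longer fits, more than `X` has been spent after `y`,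
and the total drop is at least 1. With `α = f {y} / (g F)`, the start is `u = 1 / g - 2 α`, and the
tangent of the logarithm at 2 gives `tlog (1 / g - 2 α) - 1 ≤ -α = tlog (1 - α)`, precisely because
`1 / g = 4 - log 4` (`tlog_start_le`). Hence `u ≤ 1 - α` at that point, that is `f S ≥ (1 - g) F`, a
contradiction (`false_of_room_lt`). If `r` fits to the end, the final solution contains `O`.

With thresholds, the same potential argument runs with relative errors of order `δ = ε / 16`. Two
facts replace exact greediness. The marginal value of each fitting element stays below about one of
its remaining thresholds (`Covered`), and augmentations examined at an earlier solution of almost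
the same value still bound `f (S ∪ {r})`, by submodularity (`false_of_thresholdLoop_le`).

For the running time of the variant, the thresholds do not depend on the guess, so one sorted list
of about `n log (n / ε) / ε` pairs serves all guesses. The linear-time augmentation passes are rare
because each one raises the value plus `M` by a factor `1 + δ` (`time_thresholdLoop_le`). -/

namespace BSM

variable {V : Type} [DecidableEq V]

/-! ### The approximation ratio -/

/-- One minus the approximation ratio. -/
noncomputable def gap : ℝ := 1 / (4 - Real.log 4)

theorem log_four : Real.log 4 = 2 * Real.log 2 := by
  rw [show (4 : ℝ) = 2 ^ 2 by norm_num, Real.log_pow]; norm_num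

theorem log_four_bounds : 1.3862 < Real.log 4 ∧ Real.log 4 < 1.3863 := by
  rw [log_four]
  constructor <;> linarith [Real.log_two_gt_d9, Real.log_two_lt_d9]

theorem ratio_eq : (3 - Real.log 4) / (4 - Real.log 4) = 1 - gap := by
  have h := log_four_bounds
  have : 4 - Real.log 4 ≠ 0 := by linarith
  unfold gap
  field_simp
  ring

theorem gap_pos : 0 < gap := by
  have h := log_four_bounds
  exact one_div_pos.2 (by linarith)

theorem inv_gap : 1 / gap = 4 - Real.log 4 := by
  unfold gap
  simp

theorem gap_gt : 0.3825 < gap := by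
  have h := log_four_bounds
  unfold gap
  rw [lt_div_iff₀ (by linarith)]
  linarith

theorem gap_lt : gap < 0.3826 := by
  have h2 := Real.log_two_lt_d9
  have h3 := log_four
  unfold gap
  rw [div_lt_iff₀ (by linarith)]
  linarith

theorem ratio_bounds : (3 - Real.log 4) / (4 - Real.log 4) > (0.6174 : ℝ) ∧
    (0.6174 : ℝ) > 0.9767 * (1 - 1 / Real.exp 1) := by
  constructor
  · rw [ratio_eq]
    linarith [gap_lt]
  · have h := Real.exp_one_lt_d9
    have : (0.367874 : ℝ) < 1 / Real.exp 1 := by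
      rw [lt_div_iff₀ (Real.exp_pos 1)]
      linarith
    linarith

/-! ### A concave potential -/

/-- The logarithm, continued to the left of `1` by its tangent. -/
noncomputable def tlog (u : ℝ) : ℝ := if 1 ≤ u then Real.log u else u - 1

theorem tlog_of_one_le {u : ℝ} (h : 1 ≤ u) : tlog u = Real.log u := if_pos h

theorem tlog_of_le_one {u : ℝ} (h : u ≤ 1) : tlog u = u - 1 := by
  rcases h.lt_or_eq with h | rfl
  · exact if_neg (not_le.2 h)
  · simp [tlog]

/-- This is concavity. The slope `1 / max u 1` cancels the guaranteed progress `max u 1` of a greedy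
step, which merges the two lower bounds on that progress into one potential. -/
theorem tlog_le_tangent (u w : ℝ) : tlog w ≤ tlog u + (w - u) / max u 1 := by
  rcases le_total 1 u with hu | hu
  · have hu0 : 0 < u := by linarith
    rw [tlog_of_one_le hu, max_eq_left hu]
    have e : (w - u) / u = w / u - 1 := by field_simp
    rw [e]
    rcases le_total 1 w with hw | hw
    · rw [tlog_of_one_le hw]
      have := Real.log_le_sub_one_of_pos (show 0 < w / u by positivity)
      rw [Real.log_div (by linarith) (by linarith)] at this
      linarith
    · rw [tlog_of_le_one hw]
      have h1 := Real.one_sub_inv_le_log_of_pos hu0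
      have h2 : u⁻¹ ≤ 1 := inv_le_one_of_one_le₀ hu
      rw [div_eq_mul_inv]
      nlinarith
  · rw [tlog_of_le_one hu, max_eq_right hu, div_one]
    rcases le_total 1 w with hw | hw
    · rw [tlog_of_one_le hw]
      linarith [Real.log_le_sub_one_of_pos (show 0 < w by linarith)]
    · rw [tlog_of_le_one hw]
      linarith

theorem tlog_strictMono : StrictMono tlog := by
  intro u w h
  have := tlog_le_tangent w u
  have h2 : (u - w) / max w 1 < 0 :=
    div_neg_of_neg_of_pos (by linarith) (lt_max_of_lt_right one_pos)
  linarith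

/-- The value of `gap` is determined here: the tangent at 2 has slope `1 / 2`, which matches the
coefficient 2 of `α`, and `1 / gap = 4 - 2 log 2` makes the constant terms cancel. Equality holds at
`α = 1 - log 2`. -/
theorem tlog_start_le (α : ℝ) : tlog (1 / gap - 2 * α) - 1 ≤ - α := by
  have h := tlog_le_tangent 2 (1 / gap - 2 * α)
  rw [tlog_of_one_le one_le_two, max_eq_left one_le_two] at h
  rw [inv_gap, log_four] at *
  linarith

/-- The end of the potential argument, where `s` is the relative loss of the threshold version (`s =
0` for exact greedy). A multiple of `s` well above 1 is needed because `tlog` flattens to the right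
of 1. -/
theorem false_of_tlog_le {α s w : ℝ} (hα : 0 ≤ α) (hs0 : 0 ≤ s) (hs1 : s ≤ 0.17)
    (hw : 1 - α + 9 * s < w) (h : tlog w ≤ tlog (1 / gap - 2 * α) - (1 - s)) : False := by
  have h1 := tlog_start_le α
  -- For `s ≤ α` the point `1 - α + s` lies on the linear branch. Otherwise `w > 1 + 8 s`, and `log
  -- (1 + 8 s) ≥ 3 s` because `1 + 8 s ≤ 8 / 3`.
  rcases le_total s α with hsα | hsα
  · have h2 := tlog_strictMono (show 1 - α + s < w by linarith)
    rw [tlog_of_le_one (by linarith)] at h2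
    linarith
  · have hw1 : 1 + 8 * s < w := by linarith
    have h2 := tlog_strictMono hw1
    rw [tlog_of_one_le (by linarith)] at h2
    have h3 := Real.one_sub_inv_le_log_of_pos (show 0 < 1 + 8 * s by linarith)
    have h4 : 1 - (1 + 8 * s)⁻¹ = 8 * s / (1 + 8 * s) := by
      field_simp; ring
    have h5 : 3 * s ≤ 8 * s / (1 + 8 * s) := by
      rw [le_div_iff₀ (by linarith)]
      nlinarith
    linarith

/-! ### Submodular functions -/

theorem Inst.cost_insert (I : Inst V) {S : Finset V} {v : V} (hv : v ∉ S) :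
    I.cost (insert v S) = I.cost S + I.c v := by
  rw [Inst.cost, Finset.sum_insert hv, add_comm, Inst.cost]

@[simp] theorem Inst.cost_empty {W : Type} (I : Inst W) : I.cost ∅ = 0 := rfl

@[simp] theorem Inst.cost_singleton {W : Type} (I : Inst W) (v : W) : I.cost {v} = I.c v := by
  simp [Inst.cost]

namespace Inst.IsBSM

variable {I : Inst V} (hI : I.IsBSM)
include hI

theorem cost_mono {S T : Finset V} (h : S ⊆ T) (hT : T ⊆ I.ground) : I.cost S ≤ I.cost T :=
  Finset.sum_le_sum_of_subset_of_nonneg h fun v hv _ => (hI.cost_pos v (hT hv)).le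

theorem cost_insert_le {S : Finset V} {v : V} (hv : v ∈ I.ground) :
    I.cost (insert v S) ≤ I.cost S + I.c v := by
  by_cases h : v ∈ S
  · rw [Finset.insert_eq_of_mem h]
    linarith [hI.cost_pos v hv]
  · rw [I.cost_insert h]

theorem le_insert {S : Finset V} {v : V} (hS : S ⊆ I.ground) (hv : v ∈ I.ground) :
    I.f S ≤ I.f (insert v S) :=
  hI.mono _ _ (Finset.subset_insert _ _) (Finset.insert_subset hv hS)

/-- Diminishing returns. -/
theorem marginal_anti {S T : Finset V} {v : V} (h : S ⊆ T) (hT : T ⊆ I.ground)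
    (hv : v ∈ I.ground) : I.f (insert v T) - I.f T ≤ I.f (insert v S) - I.f S := by
  by_cases hvT : v ∈ T
  · rw [Finset.insert_eq_of_mem hvT]
    linarith [hI.le_insert (h.trans hT) hv]
  induction T using Finset.induction_on with
  | empty => rw [Finset.subset_empty.1 h]
  | insert u T hu ih =>
    rw [Finset.insert_subset_iff] at hT
    rw [Finset.mem_insert, not_or] at hvT
    by_cases huS : u ∈ S
    · by_cases hTS : T ⊆ S
      · rw [Finset.Subset.antisymm h (Finset.insert_subset huS hTS)]
      -- Here `S ⊆ T` fails, so the induction hypothesis does not apply. Instead the elements of `T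
      -- \ S` are peeled off one at a time while `u` is kept.
      · have key : ∀ P ⊆ T, I.f (insert v (insert u T)) - I.f (insert u T) ≤
            I.f (insert v (insert u (T \ P))) - I.f (insert u (T \ P)) := by
          intro P
          induction P using Finset.induction_on with
          | empty => simp
          | insert w P hw ihP =>
            intro hP
            rw [Finset.insert_subset_iff] at hP
            refine (ihP hP.2).trans ?_
            have hwT : w ∈ T \ P := Finset.mem_sdiff.2 ⟨hP.1, hw⟩
            have e : T \ P = insert w (T \ insert w P) := by
              ext x; simp only [Finset.mem_sdiff, Finset.mem_insert]; grind
            have hsub : insert u (T \ insert w P) ⊆ I.ground :=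
              Finset.insert_subset hT.1 (Finset.sdiff_subset.trans hT.2)
            have := hI.submod _ hsub v hv w (hT.2 hP.1)
              (by simp only [Finset.mem_sdiff, Finset.mem_insert]; grind)
              (by simp only [Finset.mem_sdiff, Finset.mem_insert]; grind) (by grind)
            rw [e, Finset.insert_comm u w]
            exact this
        have e : S = insert u (T \ (T \ S)) := by
          ext x
          have := @h x
          simp only [Finset.mem_sdiff, Finset.mem_insert] at *
          grind
        rw [e]
        exact key _ Finset.sdiff_subset
    · refine (hI.submod T hT.2 v hv u hT.1 hvT.2 hu hvT.1).trans ?_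
      refine ih (fun x hx => ?_) hT.2 hvT.2
      rcases Finset.mem_insert.1 (h hx) with rfl | h'
      · exact absurd hx huS
      · exact h'

theorem union_le_add_sum {S T : Finset V} (hS : S ⊆ I.ground) (hT : T ⊆ I.ground) :
    I.f (S ∪ T) ≤ I.f S + ∑ u ∈ T, (I.f (insert u S) - I.f S) := by
  induction T using Finset.induction_on with
  | empty => simp
  | insert u T hu ih =>
    rw [Finset.insert_subset_iff] at hT
    rw [Finset.sum_insert hu, Finset.union_insert]
    have := hI.marginal_anti (Finset.subset_union_left (s₁ := S) (s₂ := T))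
      (Finset.union_subset hS hT.2) hT.1
    linarith [ih hT.2]

theorem marginal_le_single {S : Finset V} {v : V} (hS : S ⊆ I.ground) (hv : v ∈ I.ground) :
    I.f (insert v S) - I.f S ≤ I.f {v} := by
  have := hI.marginal_anti (Finset.empty_subset S) hS hv
  have h0 := hI.nonneg ∅ (Finset.empty_subset _)
  simp only [insert_empty_eq] at this
  linarith

end Inst.IsBSM

/-! ### One step of a density greedy procedure -/

/-- `y` is an element of largest value of the feasible set `O`, and `r` is an element of
largest cost among the others. -/
structure Inst.IsSplit (I : Inst V) (O : Finset V) (y r : V) : Prop where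
  sub : O ⊆ I.ground
  cost_le : I.cost O ≤ I.B
  memy : y ∈ O
  memr : r ∈ O
  ne : r ≠ y
  le_single : ∀ v ∈ O, I.f {v} ≤ I.f {y}
  cost_le_r : ∀ v ∈ O, v ≠ y → I.c v ≤ I.c r

theorem Inst.exists_isSplit (I : Inst V) {O : Finset V} (hO : I.Feasible O)
    (h2 : 2 ≤ O.card) : ∃ y r, I.IsSplit O y r := by
  obtain ⟨y, hy, hmax⟩ := O.exists_max_image (fun v => I.f {v}) (Finset.card_pos.1 (by omega))
  obtain ⟨r, hr, hrmax⟩ := (O.erase y).exists_max_image I.c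
    (Finset.card_pos.1 (by rw [Finset.card_erase_of_mem hy]; omega))
  rw [Finset.mem_erase] at hr
  exact ⟨y, r, hO.1, hO.2, hy, hr.2, hr.1, hmax,
    fun v hv hvy => hrmax v (Finset.mem_erase.2 ⟨hvy, hv⟩)⟩

/-- The value missing to `f O - f {y}`, in multiples of `gap * f O`. -/
noncomputable def Inst.missing (I : Inst V) (O : Finset V) (y : V) (S : Finset V) : ℝ :=
  (I.f O - I.f {y} - I.f S) / (gap * I.f O)

/-- The budget left for the elements of the solution other than `y` and `r`. -/
def Inst.room (I : Inst V) (y r : V) : ℝ := I.B - I.c y - I.c r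

namespace Inst.IsSplit

variable {I : Inst V} {O : Finset V} {y r : V} (hO : I.IsSplit O y r)
include hO

theorem cost_rest : I.cost ((O.erase y).erase r) ≤ I.room y r := by
  have h1 := I.cost_insert (Finset.notMem_erase y O)
  have h2 := I.cost_insert (Finset.notMem_erase r (O.erase y))
  rw [Finset.insert_erase hO.memy] at h1
  rw [Finset.insert_erase (Finset.mem_erase.2 ⟨hO.ne, hO.memr⟩)] at h2
  have := hO.cost_le
  unfold Inst.room
  linarith

/-- The step shared by both algorithms: `θ` is the density of the chosen element, or the threshold
visited. Exact greedy is the case `δ = 0`. The factor `1 + 2 * δ` allows for augmentations examined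
at an older solution, and the term with `δ / I.ground.card` for elements whose thresholds are
exhausted. -/
theorem tlog_missing_step (hI : I.IsBSM) {δ A θ : ℝ} {S S' : Finset V} {v : V}
    (hδ0 : 0 ≤ δ) (hδ1 : δ ≤ 1 / 16) (hS : S ⊆ I.ground) (hyS : y ∈ S) (hF : 0 < I.f O)
    (hA : I.f {y} ≤ A) (hAF : A ≤ (1 - 16 * δ) * (1 - gap) * I.f O)
    (hr : I.f (insert r S) ≤ (1 + 2 * δ) * A) (hθ : 0 ≤ θ)
    (hdens : ∀ u ∈ O, u ≠ y → (1 - δ) * (I.f (insert u S) - I.f S) ≤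
      θ * I.c u + δ / I.ground.card * I.f {u})
    (hc : 0 ≤ I.c v) (hv : θ * I.c v ≤ I.f S' - I.f S) :
    0 < I.room y r ∧ tlog (I.missing O y S') ≤
      tlog (I.missing O y S) - (1 - δ / gap) * (I.c v / I.room y r) := by
  have hD := gap_gt
  have hD' := gap_lt
  have hD0 := gap_pos
  set T := (O.erase y).erase r with hT
  have hTO : T ⊆ O := (Finset.erase_subset _ _).trans (Finset.erase_subset _ _)
  have ha0 : 0 ≤ I.f {y} := hI.nonneg _ (Finset.singleton_subset_iff.2 (hO.sub hO.memy))
  have hrg := hO.sub hO.memr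
  have hn : 0 < (I.ground.card : ℝ) :=
    Nat.cast_pos.2 (Finset.card_pos.2 ⟨r, hrg⟩)
  -- the value that `T` can still add
  set m := ∑ u ∈ T, (I.f (insert u S) - I.f S) with hm
  have hFle : I.f O ≤ I.f (insert r S) + m := by
    have hrS : insert r S ⊆ I.ground := Finset.insert_subset hrg hS
    have hsub : O ⊆ insert r S ∪ T := by
      intro x hx
      simp only [hT, Finset.mem_union, Finset.mem_insert, Finset.mem_erase]
      grind
    -- Marginals over `insert r S` are replaced by the larger marginals over `S`, the ones to which
    -- the density bound applies.
    refine (hI.mono _ _ hsub (Finset.union_subset hrS (hTO.trans hO.sub))).trans ?_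
    refine (hI.union_le_add_sum hrS (hTO.trans hO.sub)).trans ?_
    refine add_le_add_right (Finset.sum_le_sum fun u hu => ?_) _
    exact hI.marginal_anti (Finset.subset_insert _ _) hrS (hO.sub (hTO hu))
  have hm1 : I.f O - I.f {y} - I.f S ≤ m := by
    have h1 := hI.marginal_le_single hS hrg
    have h2 := hO.le_single r hO.memr
    linarith
  have hm2 : gap * I.f O ≤ m := by
    have : (1 + 2 * δ) * A ≤ (1 - gap) * I.f O := by
      have h1 : (1 + 2 * δ) * (1 - 16 * δ) ≤ 1 := by nlinarith
      calc (1 + 2 * δ) * A ≤ (1 + 2 * δ) * ((1 - 16 * δ) * (1 - gap) * I.f O) := by gcongr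
        _ = ((1 + 2 * δ) * (1 - 16 * δ)) * ((1 - gap) * I.f O) := by ring
        _ ≤ 1 * ((1 - gap) * I.f O) :=
          mul_le_mul_of_nonneg_right h1 (mul_nonneg (by linarith) hF.le)
        _ = _ := one_mul _
    linarith
  have hmW : gap * I.f O * max (I.missing O y S) 1 ≤ m := by
    rw [mul_max_of_nonneg _ _ (by positivity), mul_one]
    refine max_le ?_ hm2
    rw [Inst.missing, mul_div_cancel₀ _ (by positivity)]
    exact hm1
  -- The negligible terms add up to at most `δ * f {y}`, as `T` has at most `I.ground.card`
  -- elements, each of value at most `f {y}`.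
  have hsum : (1 - δ) * m ≤ θ * I.room y r + δ * I.f {y} := by
    calc (1 - δ) * m ≤ ∑ u ∈ T, (θ * I.c u + δ / I.ground.card * I.f {y}) := by
          rw [hm, Finset.mul_sum]
          refine Finset.sum_le_sum fun u hu => ?_
          refine (hdens u (hTO hu) (Finset.ne_of_mem_erase (Finset.mem_of_mem_erase hu))).trans ?_
          have := hO.le_single u (hTO hu)
          gcongr
      _ = θ * I.cost T + δ * I.f {y} * (T.card / I.ground.card) := by
          rw [Finset.sum_add_distrib, ← Finset.mul_sum, Finset.sum_const, nsmul_eq_mul, Inst.cost]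
          ring
      _ ≤ θ * I.room y r + δ * I.f {y} * 1 := by
          have h1 : (T.card : ℝ) / I.ground.card ≤ 1 := by
            rw [div_le_one hn]
            exact_mod_cast Finset.card_le_card (hTO.trans hO.sub)
          have h2 := hO.cost_rest
          gcongr
      _ = _ := by rw [mul_one]
  set W := max (I.missing O y S) 1 with hW
  have hW1 : 1 ≤ W := le_max_right _ _
  have hθX : (1 - δ / gap) * (gap * I.f O * W) ≤ θ * I.room y r := by
    have h1 : δ * I.f {y} ≤ δ * ((1 - gap) * I.f O * W) := by
      have h3 : (1 - 16 * δ) * (1 - gap) * I.f O ≤ 1 * (1 - gap) * I.f O := by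
        have : 0 ≤ 1 - gap := by linarith
        gcongr
        linarith
      have h4 : (1 - gap) * I.f O * 1 ≤ (1 - gap) * I.f O * W :=
        mul_le_mul_of_nonneg_left hW1 (mul_nonneg (by linarith) hF.le)
      gcongr
      linarith
    have h2 : (1 - δ) * (gap * I.f O * W) ≤ (1 - δ) * m :=
      mul_le_mul_of_nonneg_left hmW (by linarith)
    -- Both losses together: `(1 - δ) * gap - δ * (1 - gap) = gap - δ`.
    have h3 : (1 - δ / gap) * (gap * I.f O * W) =
        (1 - δ) * (gap * I.f O * W) - δ * ((1 - gap) * I.f O * W) := by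
      field_simp
      ring
    linarith
  have hs : 0 < 1 - δ / gap := by
    rw [sub_pos, div_lt_one hD0]
    linarith
  have hX0 : 0 ≤ I.room y r := (Finset.sum_nonneg fun u hu =>
    (hI.cost_pos u (hO.sub (hTO hu))).le).trans hO.cost_rest
  have hX : 0 < I.room y r := by
    -- With no room, `T` could cost nothing, although it still has positive value to add at a finite
    -- density.
    refine hX0.lt_of_ne fun h => ?_
    rw [← h, mul_zero] at hθX
    have : 0 < (1 - δ / gap) * (gap * I.f O * W) := by positivity
    linarith
  refine ⟨hX, (tlog_le_tangent (I.missing O y S) _).trans ?_⟩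
  have h1 : I.missing O y S' - I.missing O y S = - ((I.f S' - I.f S) / (gap * I.f O)) := by
    unfold Inst.missing
    ring
  have h2 : (1 - δ / gap) * (I.c v / I.room y r) ≤ (I.f S' - I.f S) / (gap * I.f O) / W := by
    rw [div_div, le_div_iff₀ (by positivity)]
    refine le_trans ?_ hv
    have : (1 - δ / gap) * (I.c v / I.room y r) * (gap * I.f O * W) =
      ((1 - δ / gap) * (gap * I.f O * W)) * (I.c v / I.room y r) := by ring
    rw [this]
    refine (mul_le_mul_of_nonneg_right hθX (by positivity)).trans_eq ?_
    field_simp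
  rw [h1, neg_div]
  linarith

/-- Spending at least the room lowers `tlog` by at least `1 - δ / gap`. The remaining missing value
is then too small for `f S` to stay below the target. -/
theorem false_of_room_lt (hI : I.IsBSM) {δ x : ℝ} {S : Finset V}
    (hδ0 : 0 ≤ δ) (hδ1 : δ ≤ 1 / 16) (hF : 0 < I.f O)
    (hAF : I.f S < (1 - 16 * δ) * (1 - gap) * I.f O)
    (hX : 0 < I.room y r) (hx : I.room y r ≤ x)
    (h : tlog (I.missing O y S) ≤
      tlog (I.missing O y {y}) - (1 - δ / gap) * (x / I.room y r)) : False := by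
  have hD := gap_gt
  have hD' := gap_lt
  have hD0 := gap_pos
  have ha0 : 0 ≤ I.f {y} := hI.nonneg _ (Finset.singleton_subset_iff.2 (hO.sub hO.memy))
  have hs : δ / gap ≤ 0.17 := by
    rw [div_le_iff₀ hD0]
    linarith
  refine false_of_tlog_le (α := I.f {y} / (gap * I.f O)) (s := δ / gap) (w := I.missing O y S)
    (by positivity) (by positivity) hs ?_ ?_
  · rw [Inst.missing]
    have e : 1 - I.f {y} / (gap * I.f O) + 9 * (δ / gap) =
      (gap * I.f O - I.f {y} + 9 * δ * I.f O) / (gap * I.f O) := by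
      field_simp
    rw [e]
    refine div_lt_div_of_pos_right ?_ (by positivity)
    -- The slack `9 * δ` is available because `16 * (1 - gap) > 9`.
    nlinarith [mul_nonneg hδ0 hF.le]
  · have e : I.missing O y {y} = 1 / gap - 2 * (I.f {y} / (gap * I.f O)) := by
      rw [Inst.missing]
      field_simp
      ring
    rw [e] at h
    have : 1 ≤ x / I.room y r := (one_le_div hX).2 hx
    nlinarith

end Inst.IsSplit

/-! ### Greedy⁺ on a residual instance -/

/-- A complete run of Plain Greedy on `I` that starts from the set `S 0`. -/
def Inst.IsRunFrom (I : Inst V) (ℓ : ℕ) (S : ℕ → Finset V) : Prop :=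
  (∀ i < ℓ, I.GreedyStep (S i) (S (i + 1))) ∧ ∀ v, ¬ I.CanAdd (S ℓ) v

theorem Inst.GreedyStep.subset {I : Inst V} {S S' : Finset V} (h : I.GreedyStep S S') :
    S ⊆ S' := by
  obtain ⟨v, -, -, rfl⟩ := h
  exact Finset.subset_insert _ _

theorem Inst.IsRunFrom.mono {I : Inst V} {ℓ : ℕ} {S : ℕ → Finset V} (h : I.IsRunFrom ℓ S)
    {i j : ℕ} (hij : i ≤ j) (hj : j ≤ ℓ) : S i ⊆ S j := by
  induction j, hij using Nat.le_induction with
  | base => exact subset_rfl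
  | succ j hij ih => exact (ih (by omega)).trans (h.1 j (by omega)).subset

theorem Inst.IsRunFrom.sub_ground {I : Inst V} {ℓ : ℕ} {S : ℕ → Finset V} (h : I.IsRunFrom ℓ S)
    (h0 : S 0 ⊆ I.ground) {i : ℕ} (hi : i ≤ ℓ) : S i ⊆ I.ground := by
  induction i with
  | zero => exact h0
  | succ i ih =>
    obtain ⟨v, hv, -, e⟩ := h.1 i (by omega)
    rw [e]
    exact Finset.insert_subset hv.1 (ih (by omega))

theorem Inst.IsRunFrom.cost_le {I : Inst V} {ℓ : ℕ} {S : ℕ → Finset V} (h : I.IsRunFrom ℓ S)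
    (h0 : I.cost (S 0) ≤ I.B) {i : ℕ} (hi : i ≤ ℓ) : I.cost (S i) ≤ I.B := by
  induction i with
  | zero => exact h0
  | succ i ih =>
    obtain ⟨v, hv, -, e⟩ := h.1 i (by omega)
    rw [e]
    exact hv.2.2

theorem Inst.residual_canAdd (I : Inst V) {y : V} {S : Finset V} (hy : y ∉ S) (v : V) :
    (I.residual {y}).CanAdd S v ↔ I.CanAdd (insert y S) v := by
  have hc : ∀ T, (I.residual {y}).cost T = I.cost T := fun _ => rfl
  simp only [Inst.CanAdd, hc]
  simp only [Inst.residual, Inst.cost_singleton, Finset.mem_sdiff, Finset.mem_singleton,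
    Finset.mem_insert, not_or]
  constructor
  · rintro ⟨⟨h1, h2⟩, h3, h4⟩
    refine ⟨h1, ⟨h2, h3⟩, ?_⟩
    rw [Finset.insert_comm, I.cost_insert (by simp [Ne.symm h2, hy])]
    linarith
  · rintro ⟨h1, ⟨h2, h3⟩, h4⟩
    refine ⟨⟨h1, h2⟩, h3, ?_⟩
    rw [Finset.insert_comm, I.cost_insert (by simp [Ne.symm h2, hy])] at h4
    linarith

theorem Inst.residual_f (I : Inst V) (y : V) (S : Finset V) :
    (I.residual {y}).f S = I.f (insert y S) - I.f {y} := by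
  rw [Finset.insert_eq, Finset.union_comm]
  rfl

theorem Inst.residual_density (I : Inst V) (y : V) (S : Finset V) (v : V) :
    (I.residual {y}).density S v = I.density (insert y S) v := by
  rw [Inst.density, Inst.density, I.residual_f, I.residual_f, Finset.insert_comm]
  simp [Inst.residual]

theorem Inst.residual_greedyStep (I : Inst V) {y : V} {S S' : Finset V} (hy : y ∉ S)
    (hy' : y ∉ S') :
    (I.residual {y}).GreedyStep S S' ↔ I.GreedyStep (insert y S) (insert y S') := by
  simp only [Inst.GreedyStep, I.residual_canAdd hy, I.residual_density]
  refine exists_congr fun v => and_congr_right fun hv => and_congr_right fun _ => ?_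
  have hvy : v ≠ y := fun h => hv.2.1 (h ▸ Finset.mem_insert_self _ _)
  rw [Finset.insert_comm]
  constructor
  · rintro rfl
    rfl
  · intro h
    rw [← Finset.erase_insert hy', h, Finset.erase_insert]
    simp [Ne.symm hvy, hy]

theorem Inst.residual_isGreedyRun (I : Inst V) {y : V} {ℓ : ℕ} {S : ℕ → Finset V}
    (hy : ∀ i ≤ ℓ, y ∉ S i) (h0 : S 0 = ∅) :
    (I.residual {y}).IsGreedyRun ℓ S ↔ I.IsRunFrom ℓ fun i => insert y (S i) := by
  rw [Inst.IsGreedyRun, Inst.IsRunFrom, and_iff_right h0]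
  refine and_congr (forall₂_congr fun i hi => ?_) (forall_congr' fun v => not_congr ?_)
  · exact I.residual_greedyStep (hy i hi.le) (hy (i + 1) hi)
  · exact I.residual_canAdd (hy ℓ le_rfl) v

theorem Inst.notMem_of_residual_isGreedyRun (I : Inst V) {y : V} {ℓ : ℕ} {S : ℕ → Finset V}
    (h : (I.residual {y}).IsGreedyRun ℓ S) {i : ℕ} (hi : i ≤ ℓ) : y ∉ S i := by
  have := Inst.IsRunFrom.sub_ground (I := I.residual {y}) h.2 (by rw [h.1]; simp) hi
  intro hy
  simpa [Inst.residual] using this hy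

/-- The final solution of a run, and the feasible proper augmentations of the earlier ones. -/
def Inst.candidates (I : Inst V) (ℓ : ℕ) (S : ℕ → Finset V) : Set (Finset V) :=
  {S ℓ} ∪ {T | ∃ i < ℓ, ∃ v, I.CanAdd (S i) v ∧ T = insert v (S i)}

theorem mem_greedyPlus_residual {I : Inst V} (hI : I.IsBSM) {y : V} (hy : y ∈ I.ground)
    {ℓ : ℕ} {S : ℕ → Finset V} {T : Finset V} (hS : ∀ i ≤ ℓ, y ∉ S i) (h0 : S 0 = ∅)
    (hrun : I.IsRunFrom ℓ fun i => insert y (S i)) (hyT : y ∉ T)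
    (hT : IsBest I.f (I.candidates ℓ fun i => insert y (S i)) (insert y T)) :
    T ∈ greedyPlus (I.residual {y}) := by
  have hg : ∀ i ≤ ℓ, insert y (S i) ⊆ I.ground := fun i hi =>
    hrun.sub_ground (by simp [h0, hy]) hi
  refine ⟨ℓ, S, (I.residual_isGreedyRun hS h0).2 hrun, ?_, ?_⟩
  · rcases hT.1 with h | ⟨i, hi, v, hv, h⟩
    · left
      rw [Set.mem_singleton_iff] at h ⊢
      rw [← Finset.erase_insert hyT, h, Finset.erase_insert (hS ℓ le_rfl)]
    · right
      have hv' := (I.residual_canAdd (hS i hi.le) v).2 hv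
      have hvy : v ≠ y := fun h => hv.2.1 (h ▸ Finset.mem_insert_self _ _)
      refine ⟨i, hi, v, hv'.1, hv'.2.2, ?_⟩
      rw [← Finset.erase_insert hyT, h, Finset.insert_comm, Finset.erase_insert]
      simp [Ne.symm hvy, hS i hi.le]
  · have hℓ := hT.2 _ (Or.inl rfl)
    rintro T' (rfl | ⟨i, hi, v, hv, hc, rfl⟩)
    · rw [I.residual_f, I.residual_f]
      linarith
    · rw [I.residual_f, I.residual_f, sub_le_sub_iff_right]
      by_cases hvS : v ∈ S i
      · rw [Finset.insert_eq_of_mem hvS]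
        exact (hI.mono _ _ (hrun.mono hi.le le_rfl) (hg ℓ le_rfl)).trans hℓ
      · refine hT.2 _ (Or.inr ⟨i, hi, v, ?_, Finset.insert_comm _ _ _⟩)
        exact (I.residual_canAdd (hS i hi.le) v).1 ⟨hv, hvS, hc⟩

/-- Densities do not change when the constant `f {y}` is subtracted, so a run on the residual
instance is a run on `I` started from `{y}`. -/
theorem exists_run_of_mem_greedyPlus_residual {I : Inst V} {y : V}
    {T : Finset V} (hT : T ∈ greedyPlus (I.residual {y})) :
    ∃ (ℓ : ℕ) (S : ℕ → Finset V), S 0 = {y} ∧ I.IsRunFrom ℓ S ∧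
      insert y T ∈ I.candidates ℓ S ∧ ∀ T' ∈ I.candidates ℓ S, I.f T' ≤ I.f (insert y T) := by
  obtain ⟨ℓ, S, hrun, hT, hmax⟩ := hT
  have hS := fun i (hi : i ≤ ℓ) => I.notMem_of_residual_isGreedyRun hrun hi
  have hrun' := (I.residual_isGreedyRun hS hrun.1).1 hrun
  refine ⟨ℓ, fun i => insert y (S i), by simp [hrun.1], hrun', ?_, ?_⟩
  · rcases hT with rfl | ⟨i, hi, v, hv, hc, rfl⟩
    · exact Or.inl rfl
    · by_cases hvS : v ∈ S i
      -- An improper augmentation is the current solution itself. Unless that is the initial one, it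
      -- is the greedy augmentation of its predecessor, hence a proper candidate.
      · rcases i with _ | i
        · simp [hrun.1] at hvS
        · obtain ⟨w, hw, -, e⟩ := hrun'.1 i (by omega)
          exact Or.inr ⟨i, by omega, w, hw, by rwa [Finset.insert_eq_of_mem hvS]⟩
      · exact Or.inr ⟨i, hi, v, (I.residual_canAdd (hS i hi.le) v).1 ⟨hv, hvS, hc⟩,
          Finset.insert_comm _ _ _⟩
  · intro T' hT'
    have key : ∃ P, T' = insert y P ∧ (I.residual {y}).f P ≤ (I.residual {y}).f T := by
      rcases hT' with rfl | ⟨i, hi, v, hv, rfl⟩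
      · exact ⟨_, rfl, hmax _ (Or.inl rfl)⟩
      · refine ⟨insert v (S i), Finset.insert_comm _ _ _, hmax _ (Or.inr ⟨i, hi, v, ?_⟩)⟩
        have := (I.residual_canAdd (hS i hi.le) v).2 hv
        exact ⟨this.1, this.2.2, rfl⟩
    obtain ⟨P, rfl, hP⟩ := key
    rw [I.residual_f, I.residual_f] at hP
    linarith

/-! ### The approximation ratio of 1-Guess Greedy⁺ -/

/-- The potential drops in proportion to the cost spent for as long as `r` fits; then either `r`
stops fitting or the run has absorbed `O`. -/
theorem Inst.IsSplit.ratio_le_of_run {I : Inst V} (hI : I.IsBSM) {O : Finset V} {y r : V}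
    (hO : I.IsSplit O y r) {ℓ : ℕ} {S : ℕ → Finset V} (h0 : S 0 = {y}) (hrun : I.IsRunFrom ℓ S)
    {A : ℝ} (hA : ∀ T ∈ I.candidates ℓ S, I.f T ≤ A) : (1 - gap) * I.f O ≤ A := by
  by_contra! hlt
  have hD := gap_pos
  have hD' := gap_lt
  have hyg := hO.sub hO.memy
  have h0g : S 0 ⊆ I.ground := by simp [h0, hyg]
  have hg : ∀ i ≤ ℓ, S i ⊆ I.ground := fun i hi => hrun.sub_ground h0g hi
  have hyS : ∀ i ≤ ℓ, y ∈ S i := fun i hi => hrun.mono (Nat.zero_le i) hi (by simp [h0])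
  have hSA : ∀ i ≤ ℓ, I.f (S i) ≤ A := fun i hi =>
    (hI.mono _ _ (hrun.mono hi le_rfl) (hg ℓ le_rfl)).trans (hA _ (Or.inl rfl))
  have hyA : I.f {y} ≤ A := h0 ▸ hSA 0 (Nat.zero_le _)
  have hF : 0 < I.f O := by
    have := hI.nonneg {y} (by simpa using hyg)
    have h1 : 0 < (1 - gap) * I.f O := by linarith
    exact pos_of_mul_pos_right h1 (by linarith)
  -- the invariant as long as `r` fits
  have key : ∀ i ≤ ℓ, (∀ j < i, I.cost (S j) + I.c r ≤ I.B) →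
      tlog (I.missing O y (S i)) ≤ tlog (I.missing O y {y}) -
        (1 - 0 / gap) * ((I.cost (S i) - I.c y) / I.room y r) ∧ (0 < i → 0 < I.room y r) := by
    intro i
    induction i with
    | zero => simp [h0]
    | succ i ih =>
      intro hi hfit
      obtain ⟨ih, -⟩ := ih (by omega) fun j hj => hfit j (by omega)
      have hfit := hfit i (by omega)
      obtain ⟨v, hv, hmax, e⟩ := hrun.1 i (by omega)
      -- This is why `r` has largest cost: when it fits, greedy competes with every missing element
      -- of `O`.
      have hcan : ∀ u ∈ O, u ≠ y → u ∉ S i → I.CanAdd (S i) u := fun u hu huy huS =>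
        ⟨hO.sub hu, huS, by rw [I.cost_insert huS]; linarith [hO.cost_le_r u hu huy]⟩
      have hrA : I.f (insert r (S i)) ≤ A := by
        by_cases hrS : r ∈ S i
        · rw [Finset.insert_eq_of_mem hrS]
          exact hSA i (by omega)
        · exact hA _ (Or.inr ⟨i, by omega, r, hcan r hO.memr hO.ne hrS, rfl⟩)
      have hθ : 0 ≤ I.density (S i) v :=
        div_nonneg (sub_nonneg.2 (hI.le_insert (hg i (by omega)) hv.1)) (hI.cost_pos v hv.1).le
      have hvc := hI.cost_pos v hv.1
      obtain ⟨hX, hstep⟩ := hO.tlog_missing_step hI (δ := 0) (A := A) (θ := I.density (S i) v)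
        (S := S i) (S' := S (i + 1)) (v := v) le_rfl (by norm_num) (hg i (by omega))
        (hyS i (by omega)) hF hyA (by linarith) (by linarith) hθ
        (by
          intro u hu huy
          have huc := hI.cost_pos u (hO.sub hu)
          by_cases huS : u ∈ S i
          · rw [Finset.insert_eq_of_mem huS]
            simpa using mul_nonneg hθ huc.le
          · have := hmax u (hcan u hu huy huS)
            have h2 : I.density (S i) u * I.c u = I.f (insert u (S i)) - I.f (S i) :=
              div_mul_cancel₀ _ huc.ne'
            have h3 := mul_le_mul_of_nonneg_right this huc.le
            rw [h2] at h3
            simpa using h3)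
        hvc.le (by rw [e]; exact (div_mul_cancel₀ _ hvc.ne').le)
      refine ⟨?_, fun _ => hX⟩
      have hc : I.cost (S (i + 1)) = I.cost (S i) + I.c v := by rw [e, I.cost_insert hv.2.1]
      rw [hc, show I.cost (S i) + I.c v - I.c y = (I.cost (S i) - I.c y) + I.c v by ring, add_div]
      linarith
  by_cases hall : ∀ i ≤ ℓ, I.cost (S i) + I.c r ≤ I.B
  · have hsub : O ⊆ S ℓ := by
      intro u hu
      by_contra huS
      have huy : u ≠ y := fun h => huS (h ▸ hyS ℓ le_rfl)
      exact hrun.2 u ⟨hO.sub hu, huS, by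
        rw [I.cost_insert huS]; linarith [hO.cost_le_r u hu huy, hall ℓ le_rfl]⟩
    have := hI.mono _ _ hsub (hg ℓ le_rfl)
    have := hSA ℓ le_rfl
    nlinarith
  · push Not at hall
    classical
    obtain ⟨hi, hcost⟩ := Nat.find_spec hall
    have hmin : ∀ j < Nat.find hall, I.cost (S j) + I.c r ≤ I.B := fun j hj => by
      by_contra! h
      exact Nat.find_min hall hj ⟨by omega, h⟩
    obtain ⟨h1, h2⟩ := key _ hi hmin
    -- At the start `r` fits, since `{y, r} ⊆ O`. So at least one step was made, and positivity of
    -- the room comes from it.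
    have hpos : 0 < Nat.find hall := by
      rw [Nat.pos_iff_ne_zero]
      intro h
      rw [h, h0, Inst.cost_singleton] at hcost
      have hs : ({y, r} : Finset V) ⊆ O := by
        simp [Finset.insert_subset_iff, hO.memy, hO.memr]
      have h3 := hI.cost_mono hs hO.sub
      rw [I.cost_insert (by simp [hO.ne.symm]), I.cost_singleton] at h3
      linarith [hO.cost_le]
    refine hO.false_of_room_lt hI le_rfl (by norm_num) hF ?_ (h2 hpos) ?_ h1
    · have := hSA _ hi
      linarith
    · unfold Inst.room
      linarith

theorem candidates_feasible {I : Inst V} (hI : I.IsBSM) {y : V} (hy : y ∈ I.ground)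
    {ℓ : ℕ} {S : ℕ → Finset V} (h0 : S 0 = {y}) (hrun : I.IsRunFrom ℓ S) {T : Finset V}
    (hT : T ∈ I.candidates ℓ S) : I.Feasible T := by
  have h0g : S 0 ⊆ I.ground := by simp [h0, hy]
  rcases hT with rfl | ⟨i, hi, v, hv, rfl⟩
  · exact ⟨hrun.sub_ground h0g le_rfl,
      hrun.cost_le (by rw [h0, I.cost_singleton]; exact hI.cost_le y hy) le_rfl⟩
  · exact ⟨Finset.insert_subset hv.1 (hrun.sub_ground h0g hi.le), hv.2.2⟩

theorem Inst.IsBSM.feasible_singleton {I : Inst V} (hI : I.IsBSM) {y : V} (hy : y ∈ I.ground) :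
    I.Feasible {y} :=
  ⟨by simpa using hy, by rw [I.cost_singleton]; exact hI.cost_le y hy⟩

theorem Inst.IsBSM.feasible_empty {I : Inst V} (hI : I.IsBSM) : I.Feasible ∅ :=
  ⟨Finset.empty_subset _, by simpa using hI.budget_pos.le⟩

/-- It is enough to compare with the solutions that have at least two elements. -/
theorem Inst.IsBSM.isApprox {I : Inst V} (hI : I.IsBSM) {ρ : ℝ} (hρ : ρ ≤ 1) {T : Finset V}
    (hT : I.Feasible T) (h0 : I.f ∅ ≤ I.f T) (h1 : ∀ y ∈ I.ground, I.f {y} ≤ I.f T)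
    (h2 : ∀ O y r, I.IsSplit O y r → ρ * I.f O ≤ I.f T) : I.IsApprox ρ T := by
  refine ⟨hT, fun O hO => ?_⟩
  rcases le_or_gt 2 O.card with h | h
  · obtain ⟨y, r, hs⟩ := I.exists_isSplit hO h
    exact h2 O y r hs
  · have h3 := hI.nonneg O hO.1
    have h4 : I.f O ≤ I.f T := by
      interval_cases hc : O.card
      · rwa [Finset.card_eq_zero.1 hc]
      · obtain ⟨y, rfl⟩ := Finset.card_eq_one.1 hc
        exact h1 y (by simpa using hO.1)
    nlinarith

theorem isApprox_of_mem_guess_greedyPlus {I : Inst V} (hI : I.IsBSM) {T : Finset V}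
    (hT : T ∈ guess 1 greedyPlus I) : I.IsApprox ((3 - Real.log 4) / (4 - Real.log 4)) T := by
  obtain ⟨A, hA, hTmem, hTmax⟩ := hT
  have hrun : ∀ y ∈ I.ground, ∃ (ℓ : ℕ) (S : ℕ → Finset V), S 0 = {y} ∧ I.IsRunFrom ℓ S ∧
      A {y} ∪ {y} ∈ I.candidates ℓ S ∧
      ∀ T' ∈ I.candidates ℓ S, I.f T' ≤ I.f (A {y} ∪ {y}) := by
    intro y hy
    have := exists_run_of_mem_greedyPlus_residual
      (hA {y} (hI.feasible_singleton hy) (Finset.card_singleton y))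
    rwa [Finset.insert_eq, Finset.union_comm] at this
  have hmax : ∀ y ∈ I.ground, I.f (A {y} ∪ {y}) ≤ I.f T := fun y hy =>
    hTmax _ (Or.inl ⟨{y}, hI.feasible_singleton hy, Finset.card_singleton y, rfl⟩)
  have hTf : I.Feasible T := by
    rcases hTmem with ⟨Y, hY, hc, rfl⟩ | ⟨h, -⟩
    · obtain ⟨y, rfl⟩ := Finset.card_eq_one.1 hc
      have hy : y ∈ I.ground := by simpa using hY.1
      obtain ⟨ℓ, S, h0, hr, hm, -⟩ := hrun y hy
      exact candidates_feasible hI hy h0 hr hm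
    · exact h
  rw [ratio_eq]
  refine hI.isApprox (by linarith [gap_pos]) hTf
    (hTmax _ (Or.inr ⟨hI.feasible_empty, by simp⟩)) (fun y hy => ?_) fun O y r hO => ?_
  · refine le_trans ?_ (hmax y hy)
    have hs : A {y} ∪ {y} ⊆ I.ground := by
      obtain ⟨ℓ, S, h0, hr, hm, -⟩ := hrun y hy
      exact (candidates_feasible hI hy h0 hr hm).1
    exact hI.mono _ _ Finset.subset_union_right hs
  · obtain ⟨ℓ, S, h0, hr, -, hm⟩ := hrun y (hO.sub hO.memy)
    exact (hO.ratio_le_of_run hI h0 hr hm).trans (hmax y (hO.sub hO.memy))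

/-! ### Counting steps -/

@[simp] theorem Timed.val_bind {α β : Type} (x : Timed α) (g : α → Timed β) :
    (x >>= g).val = (g x.val).val := rfl

@[simp] theorem Timed.time_bind {α β : Type} (x : Timed α) (g : α → Timed β) :
    (x >>= g).time = x.time + (g x.val).time := rfl

@[simp] theorem val_op {α : Type} (a : α) : (op a).val = a := rfl

@[simp] theorem time_op {α : Type} (a : α) : (op a).time = 1 := rfl

/-- Spend one more step. -/
def Timed.tick {α : Type} (x : Timed α) : Timed α := ⟨x.val, x.time + 1⟩

@[simp] theorem Timed.val_tick {α : Type} (x : Timed α) : x.tick.val = x.val := rfl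

@[simp] theorem Timed.time_tick {α : Type} (x : Timed α) : x.tick.time = x.time + 1 := rfl

/-- In this form charged steps move outwards, and the branch on a computed value is exposed at once.
-/
theorem op_bind {α β : Type} (a : α) (g : α → Timed β) : (op a >>= g) = (g a).tick :=
  congrArg (Timed.mk _) (Nat.add_comm _ _)

theorem eval_bind {β : Type} (I : Inst V) (S : List V) (g : ℝ → Timed β) :
    (eval I S >>= g) = (g (I.f S.toFinset)).tick := op_bind _ _

theorem val_remove (v : V) (R : List V) : (remove v R).val = R.erase v := by
  induction R with
  | nil => rfl
  | cons u R ih =>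
    simp only [remove, op_bind, Timed.val_tick, List.erase_cons, beq_iff_eq, decide_eq_true_eq]
    split_ifs <;> simp [ih]

theorem time_remove_le (v : V) (R : List V) : (remove v R).time ≤ 2 * R.length + 1 := by
  induction R with
  | nil => simp [remove]
  | cons u R ih =>
    simp only [remove, op_bind, Timed.time_tick, List.length_cons]
    split_ifs <;> simp <;> omega

theorem val_len {α : Type} (R : List α) : (len R).val = R.length := by
  induction R with
  | nil => rfl
  | cons u R ih => simp [len, ih]

theorem time_len {α : Type} (R : List α) : (len R).time = R.length + 1 := by
  induction R with
  | nil => rfl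
  | cons u R ih => simp [len, ih]

theorem val_record {W : Type} (b : ℝ × List W) (a : ℝ) (S : List W) :
    (record b a S).val = if b.1 ≤ a then (a, S) else b := by
  simp only [BSM.record, op_bind, Timed.val_tick, decide_eq_true_eq]
  split_ifs <;> rfl

theorem time_record {W : Type} (b : ℝ × List W) (a : ℝ) (S : List W) : (record b a S).time = 2 := by
  simp only [record, op_bind, Timed.time_tick]
  split_ifs <;> rfl

theorem time_denser_le {W : Type} (p : Option (ℝ × W × ℝ)) (d : ℝ) (v : W) (a : ℝ) :
    (denser p d v a).time ≤ 2 := by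
  cases p with
  | none => simp [denser]
  | some q =>
    simp only [denser, op_bind, Timed.time_tick]
    split_ifs <;> simp

theorem time_scan_le (I : Inst V) (S : List V) (κ a : ℝ) (R : List V)
    (p : Option (ℝ × V × ℝ)) (b : ℝ × List V) :
    (scan I S κ a R p b).time ≤ 11 * R.length + 1 := by
  induction R generalizing p b with
  | nil => simp [scan]
  | cons v R ih =>
    simp only [scan, op_bind, eval_bind, Timed.time_tick, List.length_cons]
    split_ifs
    · simp only [Timed.time_tick, Timed.time_bind, time_record]
      have := time_denser_le p ((I.f (v :: S).toFinset - a) / I.c v) v (I.f (v :: S).toFinset)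
      have := ih (denser p ((I.f (v :: S).toFinset - a) / I.c v) v (I.f (v :: S).toFinset)).val
        (record b (I.f (v :: S).toFinset) (v :: S)).val
      omega
    · have := ih p b
      omega

theorem time_greedyLoop_le (I : Inst V) {N : ℕ} (k : ℕ) (R S : List V) (κ a : ℝ)
    (b : ℝ × List V) (hR : R.length ≤ N) :
    (greedyLoop I k R S κ a b).time ≤ (13 * N + 5) * (k + 1) := by
  induction k generalizing R S κ a b with
  | zero => simp [greedyLoop]
  | succ k ih =>
    simp only [greedyLoop, Timed.time_bind]
    have h1 := time_scan_le I S κ a R none b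
    have h0 : 13 * N + 5 ≤ (13 * N + 5) * (k + 1) := Nat.le_mul_of_pos_right _ (by omega)
    rw [mul_add_one]
    split
    · rw [time_op]
      omega
    · rename_i q _
      simp only [Timed.time_bind, val_op, time_op]
      have h2 := time_remove_le q.2.1 R
      have h3 := ih (remove q.2.1 R).val (q.2.1 :: S) (κ + I.c q.2.1) q.2.2
        (scan I S κ a R none b).val.2
        (by rw [val_remove]; exact (List.length_erase_le ..).trans hR)
      omega

theorem time_guessLoop_le (I : Inst V) (l G : List V) (b : ℝ × List V) :
    (guessLoop I l G b).time ≤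
      (13 * l.length ^ 2 + 22 * l.length + 13) * G.length + 1 := by
  induction G generalizing b with
  | nil => simp [guessLoop]
  | cons y G ih =>
    simp only [guessLoop, op_bind, eval_bind, Timed.time_tick, List.length_cons, mul_add_one]
    split_ifs
    · simp only [Timed.time_tick, Timed.time_bind, time_len, time_record, val_remove, val_len]
      have h1 := time_remove_le y l
      have h2 : (l.erase y).length ≤ l.length := List.length_erase_le ..
      have h3 := time_greedyLoop_le I (l.erase y).length (l.erase y) [y] (I.c y)
        (I.f [y].toFinset) (I.f [y].toFinset, [y]) h2
      have h4 := h3.trans (Nat.mul_le_mul_left _ (Nat.add_le_add_right h2 1))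
      have e : (13 * l.length + 5) * (l.length + 1) = 13 * l.length ^ 2 + 18 * l.length + 5 := by
        ring
      rw [e] at h4
      generalize hr : record _ _ _ = r
      have h5 := ih r.val
      omega
    · have := ih b
      omega

theorem time_oneGuessGreedyPlus_le (I : Inst V) (l : List V) (hl : l ≠ []) :
    (oneGuessGreedyPlus I l).time ≤ 51 * l.length ^ 3 := by
  simp only [oneGuessGreedyPlus, eval_bind, Timed.time_tick, Timed.time_bind, time_op]
  have h := time_guessLoop_le I l l (I.f [].toFinset, [])
  have h1 : 1 ≤ l.length := List.length_pos_of_ne_nil hl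
  have h2 : l.length ≤ l.length ^ 2 := by nlinarith
  have h3 : l.length ^ 2 ≤ l.length ^ 3 := by nlinarith
  have e : (13 * l.length ^ 2 + 22 * l.length + 13) * l.length =
    13 * l.length ^ 3 + 22 * l.length ^ 2 + 13 * l.length := by ring
  omega

/-! ### The implementation of 1-Guess Greedy⁺ is correct -/

/-- `b` records a best set of the family `𝒮` together with its value; it is the initial record `b₀`
as long as `𝒮` is empty. -/
structure Incumbent (I : Inst V) (b₀ : ℝ × List V) (𝒮 : Set (Finset V)) (b : ℝ × List V) :
    Prop where
  val_eq : b.1 = I.f b.2.toFinset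
  le : ∀ T ∈ 𝒮, I.f T ≤ b.1
  mem : b.2.toFinset ∈ 𝒮 ∨ 𝒮 = ∅ ∧ b = b₀

/-- The initial record need not belong to the family. Since `record` replaces on ties and `b₀.1 ≤
a`, the first candidate evicts it. -/
theorem Incumbent.record {I : Inst V} {b₀ b : ℝ × List V} {𝒮 : Set (Finset V)}
    (h : Incumbent I b₀ 𝒮 b) {a : ℝ} {S : List V} (ha : a = I.f S.toFinset) (h₀ : b₀.1 ≤ a) :
    Incumbent I b₀ (𝒮 ∪ {S.toFinset}) (record b a S).val := by
  rw [val_record]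
  split_ifs with hb
  · refine ⟨ha, ?_, Or.inl (Or.inr rfl)⟩
    rintro T (hT | rfl)
    · exact (h.le T hT).trans hb
    · exact ha.ge
  · refine ⟨h.val_eq, ?_, Or.inl (Or.inl ?_)⟩
    · rintro T (hT | rfl)
      · exact h.le T hT
      · exact ha ▸ (not_le.1 hb).le
    · rcases h.mem with hm | ⟨-, rfl⟩
      · exact hm
      · exact absurd h₀ hb

/-- `p` is an element of `Z` of maximum density with respect to `S`, together with its density and
the value it leads to. -/
def Densest (I : Inst V) (S : Finset V) (Z : Set V) : Option (ℝ × V × ℝ) → Prop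
  | none => Z = ∅
  | some q => q.2.1 ∈ Z ∧ q.1 = I.density S q.2.1 ∧ q.2.2 = I.f (insert q.2.1 S) ∧
      ∀ u ∈ Z, I.density S u ≤ q.1

theorem Densest.denser {I : Inst V} {S : Finset V} {Z : Set V} {p : Option (ℝ × V × ℝ)}
    (h : Densest I S Z p) (v : V) :
    Densest I S (insert v Z) (denser p (I.density S v) v (I.f (insert v S))).val := by
  cases p with
  | none =>
    have h : Z = ∅ := h
    simp [BSM.denser, Densest, h]
  | some q =>
    obtain ⟨h1, h2, h3, h4⟩ := h
    simp only [BSM.denser, op_bind, Timed.val_tick, decide_eq_true_eq]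
    split_ifs with hq
    · refine ⟨Set.mem_insert _ _, rfl, rfl, ?_⟩
      rintro u (rfl | hu)
      · exact le_rfl
      · exact (h4 u hu).trans hq.le
    · refine ⟨Set.mem_insert_of_mem _ h1, h2, h3, ?_⟩
      rintro u (rfl | hu)
      · exact not_lt.1 hq
      · exact h4 u hu

theorem scan_spec {I : Inst V} (hI : I.IsBSM) {S : List V} {κ a : ℝ} (hκ : κ = I.cost S.toFinset)
    (ha : a = I.f S.toFinset) (hS : S.toFinset ⊆ I.ground) {b₀ : ℝ × List V} (h₀ : b₀.1 ≤ a)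
    (R : List V) (hR : ∀ v ∈ R, v ∈ I.ground ∧ v ∉ S) {p : Option (ℝ × V × ℝ)}
    {b : ℝ × List V} {Z : Set V} {𝒮 : Set (Finset V)}
    (hp : Densest I S.toFinset Z p) (hb : Incumbent I b₀ 𝒮 b) :
    Densest I S.toFinset (Z ∪ {v | v ∈ R ∧ I.CanAdd S.toFinset v}) (scan I S κ a R p b).val.1 ∧
    Incumbent I b₀ (𝒮 ∪ {T | ∃ v ∈ R, I.CanAdd S.toFinset v ∧ T = insert v S.toFinset})
      (scan I S κ a R p b).val.2 := by
  induction R generalizing p b Z 𝒮 with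
  | nil => simpa [scan] using ⟨hp, hb⟩
  | cons v R ih =>
    obtain ⟨hvg, hvS⟩ := hR v List.mem_cons_self
    have hvS' : v ∉ S.toFinset := by simpa using hvS
    have hR' : ∀ u ∈ R, u ∈ I.ground ∧ u ∉ S := fun u hu => hR u (List.mem_cons_of_mem _ hu)
    have hfit : I.CanAdd S.toFinset v ↔ κ + I.c v ≤ I.B := by
      simp only [Inst.CanAdd, hvg, hvS', true_and, not_false_eq_true, I.cost_insert hvS', hκ]
    simp only [scan, op_bind, eval_bind, Timed.val_tick, decide_eq_true_eq, List.toFinset_cons]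
    split_ifs with hf
    · simp only [Timed.val_tick, Timed.val_bind]
      have hd : (I.f (insert v S.toFinset) - a) / I.c v = I.density S.toFinset v := by
        rw [ha]; rfl
      rw [hd]
      have key := ih hR' (hp.denser v) (hb.record (a := I.f (insert v S.toFinset))
        (S := v :: S) (by simp) (h₀.trans (ha ▸ hI.le_insert hS hvg)))
      have hv := hfit.2 hf
      convert key using 2
      · ext u
        simp only [Set.mem_union, Set.mem_ofPred_eq, List.mem_cons, Set.mem_insert_iff, or_and_right,
          or_assoc]
        have : u = v ∧ I.CanAdd S.toFinset u ↔ u = v := and_iff_left_of_imp fun h => h ▸ hv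
        rw [this, or_left_comm]
      · ext u
        simp only [Set.mem_union, Set.mem_ofPred_eq, List.mem_cons, Set.mem_singleton_iff,
          List.toFinset_cons, exists_eq_or_imp, hv, true_and, or_assoc]
    · have key := ih hR' hp hb
      have hv := mt hfit.1 hf
      convert key using 2
      · ext u
        simp only [Set.mem_union, Set.mem_ofPred_eq, List.mem_cons, or_and_right]
        have : ¬(u = v ∧ I.CanAdd S.toFinset u) := fun h => hv (h.1 ▸ h.2)
        simp only [this, false_or]
      · ext u
        simp only [Set.mem_union, Set.mem_ofPred_eq, List.mem_cons, exists_eq_or_imp, hv, false_and,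
          false_or]

/-- Only augmentations are recorded: the final solution of a nontrivial run is itself an
augmentation of the previous one. -/
theorem greedyLoop_spec {I : Inst V} (hI : I.IsBSM) {b₀ : ℝ × List V} (k : ℕ) {R S : List V}
    {κ a : ℝ} (hκ : κ = I.cost S.toFinset) (ha : a = I.f S.toFinset) (hS : S.toFinset ⊆ I.ground)
    (h₀ : b₀.1 ≤ a) (hRn : R.Nodup) (hR : ∀ v, v ∈ R ↔ v ∈ I.ground ∧ v ∉ S) (hk : R.length ≤ k)
    {b : ℝ × List V} {𝒮 : Set (Finset V)} (hb : Incumbent I b₀ 𝒮 b) :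
    ∃ (ℓ : ℕ) (T : ℕ → Finset V), T 0 = S.toFinset ∧ I.IsRunFrom ℓ T ∧
      Incumbent I b₀ (𝒮 ∪ {T' | ∃ i < ℓ, ∃ v, I.CanAdd (T i) v ∧ T' = insert v (T i)})
        (greedyLoop I k R S κ a b).val := by
  induction k generalizing R S κ a b 𝒮 with
  | zero =>
    have hR0 : R = [] := List.length_eq_zero_iff.1 (by omega)
    refine ⟨0, fun _ => S.toFinset, rfl, ⟨by simp, fun v hv => ?_⟩, by simpa [greedyLoop] using hb⟩
    have := (hR v).2 ⟨hv.1, by simpa using hv.2.1⟩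
    simp [hR0] at this
  | succ k ih =>
    have hmem : ∀ v, I.CanAdd S.toFinset v → v ∈ R := fun v hv =>
      (hR v).2 ⟨hv.1, by simpa using hv.2.1⟩
    obtain ⟨h1, h2⟩ := scan_spec hI hκ ha hS h₀ R (fun v hv => (hR v).1 hv) (Z := ∅) (p := none)
      rfl hb
    have e1 : ∅ ∪ {v | v ∈ R ∧ I.CanAdd S.toFinset v} = {v | I.CanAdd S.toFinset v} := by
      ext v
      simpa using hmem v
    have e2 : {T | ∃ v ∈ R, I.CanAdd S.toFinset v ∧ T = insert v S.toFinset} =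
        {T | ∃ v, I.CanAdd S.toFinset v ∧ T = insert v S.toFinset} := by
      ext T
      constructor
      · rintro ⟨v, -, hv⟩
        exact ⟨v, hv⟩
      · rintro ⟨v, hv⟩
        exact ⟨v, hmem v hv.1, hv⟩
    rw [e1] at h1
    rw [e2] at h2
    simp only [greedyLoop, Timed.val_bind]
    generalize hr : (scan I S κ a R none b).val = r at h1 h2 ⊢
    obtain ⟨p, b'⟩ := r
    cases p with
    | none =>
      have h1 : {v | I.CanAdd S.toFinset v} = ∅ := h1
      have hno : ∀ v, ¬ I.CanAdd S.toFinset v := fun v hv => by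
        have : v ∈ {v | I.CanAdd S.toFinset v} := hv
        simp [h1] at this
      refine ⟨0, fun _ => S.toFinset, rfl, ⟨by simp, hno⟩, ?_⟩
      simpa [hno] using h2
    | some q =>
      obtain ⟨d, v, a'⟩ := q
      obtain ⟨hv, hd, ha', hmax⟩ := h1
      simp only at hv hd ha' hmax
      subst hd
      have hv : I.CanAdd S.toFinset v := hv
      have hvR := hmem v hv
      simp only [Timed.val_bind, val_op, val_remove]
      obtain ⟨ℓ, T, hT0, hrun, hinc⟩ := ih (R := R.erase v) (S := v :: S) (κ := κ + I.c v)
        (a := a') (by rw [List.toFinset_cons, I.cost_insert hv.2.1, hκ])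
        (by rw [List.toFinset_cons, ha'])
        (by rw [List.toFinset_cons]; exact Finset.insert_subset hv.1 hS)
        (h₀.trans (by rw [ha, ha']; exact hI.le_insert hS hv.1))
        (hRn.erase v)
        (fun u => by
          rw [hRn.mem_erase_iff, hR, List.mem_cons]
          tauto)
        (by rw [List.length_erase_of_mem hvR]; omega) h2
      rw [List.toFinset_cons] at hT0
      refine ⟨ℓ + 1, fun i => i.casesOn S.toFinset T, rfl, ⟨?_, hrun.2⟩, ?_⟩
      · rintro (_ | i) hi
        · exact ⟨v, hv, fun u hu => hmax u hu, hT0⟩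
        · exact hrun.1 i (by omega)
      · convert hinc using 1
        ext T'
        simp only [Set.mem_union, Set.mem_ofPred_eq, or_assoc]
        refine or_congr_right ?_
        constructor
        · rintro ⟨_ | i, hi, h⟩
          · exact Or.inl h
          · exact Or.inr ⟨i, by omega, h⟩
        · rintro (h | ⟨i, hi, h⟩)
          · exact ⟨0, by omega, h⟩
          · exact ⟨i + 1, by omega, h⟩

/-- What the implementation finds for the guess `y`. -/
noncomputable def guessRecord (I : Inst V) (l : List V) (y : V) : ℝ × List V :=
  (greedyLoop I (l.erase y).length (l.erase y) [y] (I.c y) (I.f {y}) (I.f {y}, [y])).val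

theorem guessRecord_spec {I : Inst V} (hI : I.IsBSM) {l : List V} (hl : l.Nodup)
    (hlg : l.toFinset = I.ground) {y : V} (hy : y ∈ I.ground) :
    (guessRecord I l y).2.toFinset.erase y ∈ greedyPlus (I.residual {y}) ∧
      y ∈ (guessRecord I l y).2.toFinset ∧ (guessRecord I l y).2.toFinset ⊆ I.ground ∧
      (guessRecord I l y).1 = I.f (guessRecord I l y).2.toFinset := by
  have hmem : ∀ v, v ∈ l ↔ v ∈ I.ground := fun v => by rw [← hlg, List.mem_toFinset]
  obtain ⟨ℓ, T, hT0, hrun, hinc⟩ := greedyLoop_spec hI (b₀ := (I.f {y}, [y])) (l.erase y).length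
    (R := l.erase y) (S := [y]) (κ := I.c y) (a := I.f {y}) (by simp) (by simp)
    (by simpa using hy) le_rfl (hl.erase y)
    (fun v => by rw [hl.mem_erase_iff, hmem, List.mem_singleton, and_comm]) le_rfl
    (b := (I.f {y}, [y])) (𝒮 := ∅) ⟨by simp, by simp, Or.inr ⟨rfl, rfl⟩⟩
  change Incumbent _ _ _ (guessRecord I l y) at hinc
  rw [Set.empty_union] at hinc
  have hT0 : T 0 = {y} := by simpa using hT0
  have h0g : T 0 ⊆ I.ground := by simpa [hT0] using hy
  have hyT : ∀ i ≤ ℓ, y ∈ T i := fun i hi => hrun.mono (Nat.zero_le i) hi (by simp [hT0])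
  set P := (guessRecord I l y).2.toFinset with hP
  have hPmem : P ∈ I.candidates ℓ T := by
    rcases hinc.mem with h | ⟨h1, h2⟩
    · exact Or.inr h
    · left
      -- If nothing was recorded, no step was made, and the initial record `{y}` is the final
      -- solution.
      have hℓ : ℓ = 0 := by
        by_contra hne
        obtain ⟨v, hv, -⟩ := hrun.1 0 (by omega)
        have : insert v (T 0) ∈ (∅ : Set (Finset V)) := h1 ▸ ⟨0, by omega, v, hv, rfl⟩
        exact this
      rw [hℓ, hT0, hP, h2]
      simp
  have hyP : y ∈ P := by
    rcases hPmem with h | ⟨i, hi, v, hv, h⟩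
    · rw [h]
      exact hyT ℓ le_rfl
    · rw [h]
      exact Finset.mem_insert_of_mem (hyT i hi.le)
  have hPg : P ⊆ I.ground := (candidates_feasible hI hy hT0 hrun hPmem).1
  have hPmax : ∀ T' ∈ I.candidates ℓ T, I.f T' ≤ I.f P := by
    have h1 : ∀ i < ℓ, I.f (T (i + 1)) ≤ I.f P := fun i hi => by
      obtain ⟨v, hv, -, e⟩ := hrun.1 i hi
      exact (hinc.le _ ⟨i, hi, v, hv, e⟩).trans_eq hinc.val_eq
    rintro T' (rfl | h)
    · rcases ℓ with _ | i
      · rw [hT0]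
        exact hI.mono _ _ (by simpa using hyP) hPg
      · exact h1 i (by omega)
    · exact (hinc.le _ h).trans_eq hinc.val_eq
  refine ⟨?_, hyP, hPg, hinc.val_eq⟩
  have hfun : ∀ i ≤ ℓ, insert y ((T i).erase y) = T i := fun i hi =>
    Finset.insert_erase (hyT i hi)
  have hrun' : I.IsRunFrom ℓ fun i => insert y ((T i).erase y) := by
    refine ⟨fun i hi => ?_, fun v => ?_⟩
    · simp only [hfun i hi.le, hfun (i + 1) hi]
      exact hrun.1 i hi
    · simp only [hfun ℓ le_rfl]
      exact hrun.2 v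
  have hcand : (I.candidates ℓ fun i => insert y ((T i).erase y)) = I.candidates ℓ T := by
    unfold Inst.candidates
    simp only [hfun ℓ le_rfl]
    congr 1
    ext T'
    refine exists_congr fun i => and_congr_right fun hi => ?_
    rw [hfun i hi.le]
  refine mem_greedyPlus_residual hI hy (S := fun i => (T i).erase y)
    (fun i _ => Finset.notMem_erase _ _) (by simp [hT0]) hrun' (Finset.notMem_erase _ _) ?_
  rw [hcand, Finset.insert_erase hyP]
  exact ⟨hPmem, hPmax⟩

theorem guessLoop_spec {I : Inst V} (hI : I.IsBSM) {l : List V} (hl : l.Nodup)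
    (hlg : l.toFinset = I.ground) {b₀ : ℝ × List V} (h₀ : b₀.1 ≤ I.f ∅) (G : List V)
    (hG : ∀ y ∈ G, y ∈ I.ground) {b : ℝ × List V} {𝒮 : Set (Finset V)}
    (hb : Incumbent I b₀ 𝒮 b) :
    Incumbent I b₀ (𝒮 ∪ {T | ∃ y ∈ G, T = (guessRecord I l y).2.toFinset})
      (guessLoop I l G b).val := by
  induction G generalizing b 𝒮 with
  | nil => simpa [guessLoop] using hb
  | cons y G ih =>
    have hy := hG y List.mem_cons_self
    obtain ⟨-, -, hPg, hval⟩ := guessRecord_spec hI hl hlg hy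
    have hr := hb.record hval (h₀.trans (by
      rw [hval]
      exact hI.mono _ _ (Finset.empty_subset _) hPg))
    have := ih (fun u hu => hG u (List.mem_cons_of_mem _ hu)) hr
    simp only [guessLoop, op_bind, eval_bind, Timed.val_tick, decide_eq_true_eq,
      if_pos (hI.cost_le y hy), Timed.val_bind, val_remove, val_len]
    rw [show [y].toFinset = {y} by simp]
    rw [← guessRecord]
    convert this using 1
    ext T
    simp only [Set.mem_union, Set.mem_ofPred_eq, List.mem_cons, Set.mem_singleton_iff,
      exists_eq_or_imp, or_assoc]

theorem oneGuessGreedyPlus_mem {I : Inst V} (hI : I.IsBSM) {l : List V} (hl : l.Nodup)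
    (hlg : l.toFinset = I.ground) :
    (oneGuessGreedyPlus I l).val.toFinset ∈ guess 1 greedyPlus I := by
  have hmem : ∀ v, v ∈ l ↔ v ∈ I.ground := fun v => by rw [← hlg, List.mem_toFinset]
  have h := guessLoop_spec hI hl hlg (b₀ := (I.f ∅, [])) le_rfl l (fun y hy => (hmem y).1 hy)
    (b := (I.f ∅, [])) (𝒮 := {∅}) ⟨by simp, by simp, Or.inl (by simp)⟩
  have e : (oneGuessGreedyPlus I l).val = (guessLoop I l l (I.f ∅, [])).val.2 := by
    simp [oneGuessGreedyPlus, eval_bind]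
  rw [e]
  -- `guess` expects a function of sets; `Y.biUnion A` extends `A` from elements to singletons.
  set A : V → Finset V := fun y => (guessRecord I l y).2.toFinset.erase y with hA
  have hfam : ({T' | ∃ Y, I.Feasible Y ∧ Y.card = 1 ∧ T' = Y.biUnion A ∪ Y} ∪
      {T' | I.Feasible T' ∧ T'.card < 1} : Set (Finset V)) =
      {∅} ∪ {T | ∃ y ∈ l, T = (guessRecord I l y).2.toFinset} := by
    have hu : ∀ y ∈ I.ground, ({y} : Finset V).biUnion A ∪ {y} =
        (guessRecord I l y).2.toFinset := fun y hy => by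
      rw [Finset.singleton_biUnion, Finset.union_comm, ← Finset.insert_eq,
        Finset.insert_erase (guessRecord_spec hI hl hlg hy).2.1]
    rw [Set.union_comm]
    congr 1
    · ext T
      simp only [Set.mem_ofPred_eq, Nat.lt_one_iff, Finset.card_eq_zero, Set.mem_singleton_iff]
      constructor
      · exact fun h => h.2
      · rintro rfl
        exact ⟨hI.feasible_empty, rfl⟩
    · ext T
      constructor
      · rintro ⟨Y, hY, hc, rfl⟩
        obtain ⟨y, rfl⟩ := Finset.card_eq_one.1 hc
        have hy : y ∈ I.ground := by simpa using hY.1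
        exact ⟨y, (hmem y).2 hy, hu y hy⟩
      · rintro ⟨y, hy, rfl⟩
        have hy := (hmem y).1 hy
        exact ⟨{y}, hI.feasible_singleton hy, Finset.card_singleton y, (hu y hy).symm⟩
  refine ⟨fun Y => Y.biUnion A, fun Y hY hc => ?_, ?_⟩
  · obtain ⟨y, rfl⟩ := Finset.card_eq_one.1 hc
    simp only [Finset.singleton_biUnion]
    exact (guessRecord_spec hI hl hlg (by simpa using hY.1)).1
  · rw [hfam]
    refine ⟨?_, fun T hT => (h.le T hT).trans_eq h.val_eq⟩
    rcases h.mem with hm | ⟨h1, -⟩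
    · exact hm
    · have h2 : (∅ : Finset V) ∈ (∅ : Set (Finset V)) := h1 ▸ Or.inl rfl
      exact absurd h2 (Set.notMem_empty _)

/-! ### The list of thresholds -/

/-- The list is decreasing in the threshold. -/
def Desc {W : Type} (E : List (ℝ × W)) : Prop := E.Pairwise fun x y => y.1 ≤ x.1

theorem insertDesc_perm {W : Type} (x : ℝ × W) (E : List (ℝ × W)) :
    (insertDesc x E).val.Perm (x :: E) := by
  induction E with
  | nil => simp [insertDesc]
  | cons y E ih =>
    simp only [insertDesc, op_bind, Timed.val_tick, decide_eq_true_eq]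
    split_ifs
    · rfl
    · exact (ih.cons y).trans (List.Perm.swap x y E)

theorem Desc.insertDesc {W : Type} (x : ℝ × W) {E : List (ℝ × W)} (h : Desc E) :
    Desc (insertDesc x E).val := by
  induction E with
  | nil => simp [BSM.insertDesc, Desc]
  | cons y E ih =>
    obtain ⟨h1, h2⟩ := List.pairwise_cons.1 h
    simp only [BSM.insertDesc, op_bind, Timed.val_tick, decide_eq_true_eq]
    split_ifs with hxy
    · refine List.pairwise_cons.2 ⟨fun z hz => ?_, h⟩
      rcases List.mem_cons.1 hz with rfl | hz
      · exact hxy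
      · exact (h1 z hz).trans hxy
    · refine List.pairwise_cons.2 ⟨fun z hz => ?_, ih h2⟩
      have hz := (insertDesc_perm x E).mem_iff.1 hz
      rcases List.mem_cons.1 hz with rfl | hz
      · exact (not_le.1 hxy).le
      · exact h1 z hz

theorem time_insertDesc_le {W : Type} (x : ℝ × W) (E : List (ℝ × W)) :
    (insertDesc x E).time ≤ 2 * E.length + 1 := by
  induction E with
  | nil => simp [insertDesc]
  | cons y E ih =>
    simp only [insertDesc, op_bind, Timed.time_tick, List.length_cons]
    split_ifs
    · rw [time_op]
      omega
    · simp only [Timed.time_bind, time_op]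
      omega

theorem val_scale {W : Type} (q : ℝ) (E : List (ℝ × W)) :
    (scale q E).val = E.map fun x => (q * x.1, x.2) := by
  induction E with
  | nil => rfl
  | cons x E ih => simp [scale, ih]

theorem time_scale {W : Type} (q : ℝ) (E : List (ℝ × W)) :
    (scale q E).time = 2 * E.length + 1 := by
  induction E with
  | nil => rfl
  | cons x E ih =>
    simp only [scale, op_bind, Timed.time_tick, Timed.time_bind, time_op, ih, List.length_cons]
    ring

theorem merge_nil_left {W : Type} (E : List (ℝ × W)) : merge [] E = op E := by
  rw [merge]

theorem merge_nil_right {W : Type} (E : List (ℝ × W)) : merge E [] = op E := by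
  cases E <;> simp [merge]

theorem merge_cons_cons {W : Type} (x y : ℝ × W) (E E' : List (ℝ × W)) :
    merge (x :: E) (y :: E') = Timed.tick (if y.1 ≤ x.1 then
      merge E (y :: E') >>= fun R => op (x :: R) else
      merge (x :: E) E' >>= fun R => op (y :: R)) := by
  rw [merge]
  simp only [op_bind, decide_eq_true_eq]

theorem merge_perm {W : Type} (E E' : List (ℝ × W)) : (merge E E').val.Perm (E ++ E') := by
  induction E generalizing E' with
  | nil => simp [merge_nil_left]
  | cons x E ih =>
    induction E' with
    | nil => simp [merge_nil_right]
    | cons y E' ih' =>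
      rw [merge_cons_cons, Timed.val_tick]
      split_ifs
      · exact (ih _).cons x
      · exact (ih'.cons y).trans List.perm_middle.symm

theorem Desc.merge {W : Type} {E E' : List (ℝ × W)} (h : Desc E) (h' : Desc E') :
    Desc (merge E E').val := by
  induction E generalizing E' with
  | nil => simpa [merge_nil_left]
  | cons x E ih =>
    induction E' with
    | nil => simpa [merge_nil_right]
    | cons y E' ih' =>
      rw [merge_cons_cons, Timed.val_tick]
      obtain ⟨h1, h2⟩ := List.pairwise_cons.1 h
      obtain ⟨h1', h2'⟩ := List.pairwise_cons.1 h'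
      split_ifs with hxy
      · refine List.pairwise_cons.2 ⟨fun z hz => ?_, ih h2 h'⟩
        have hz := (merge_perm _ _).mem_iff.1 hz
        rcases List.mem_append.1 hz with hz | hz
        · exact h1 z hz
        · rcases List.mem_cons.1 hz with rfl | hz
          · exact hxy
          · exact (h1' z hz).trans hxy
      · have hxy := (not_le.1 hxy).le
        refine List.pairwise_cons.2 ⟨fun z hz => ?_, ih' h2'⟩
        have hz := (merge_perm _ _).mem_iff.1 hz
        rcases List.mem_append.1 hz with hz | hz
        · rcases List.mem_cons.1 hz with rfl | hz
          · exact hxy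
          · exact (h1 z hz).trans hxy
        · exact h1' z hz

theorem time_merge_le {W : Type} (E E' : List (ℝ × W)) :
    (merge E E').time ≤ 2 * (E.length + E'.length) + 1 := by
  induction E generalizing E' with
  | nil => simp [merge_nil_left]
  | cons x E ih =>
    induction E' with
    | nil => simp [merge_nil_right]
    | cons y E' ih' =>
      rw [merge_cons_cons, Timed.time_tick]
      have := ih (y :: E')
      simp only [List.length_cons] at *
      split_ifs
      · simp only [Timed.time_bind, time_op]
        omega
      · simp only [Timed.time_bind, time_op]
        omega

/-- `E` lists the first `m` thresholds of all elements of `l` of positive value. -/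
structure IsThresholds (I : Inst V) (l : List V) (δ : ℝ) (m : ℕ) (E : List (ℝ × V)) : Prop where
  desc : Desc E
  length_le : E.length ≤ l.length * m
  mem_iff : ∀ x, x ∈ E ↔ x.2 ∈ l ∧ 0 < I.f {x.2} ∧
    ∃ j < m, x.1 = I.f {x.2} / I.c x.2 * (1 - δ) ^ j

theorem firstThresholds_spec (I : Inst V) (δ : ℝ) (l : List V) :
    IsThresholds I l δ 1 (firstThresholds I l).val.2 ∧ 0 ≤ (firstThresholds I l).val.1 ∧
    (∀ v ∈ l, I.f {v} ≤ (firstThresholds I l).val.1) ∧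
    ((firstThresholds I l).val.1 = 0 ∨ ∃ v ∈ l, (firstThresholds I l).val.1 = I.f {v}) := by
  induction l with
  | nil => exact ⟨⟨by simp [firstThresholds, Desc], by simp [firstThresholds],
      by simp [firstThresholds]⟩, by simp [firstThresholds]⟩
  | cons v R ih =>
    obtain ⟨h1, h2, h3, h4⟩ := ih
    simp only [firstThresholds, Timed.val_bind, op_bind, eval_bind, Timed.val_tick,
      decide_eq_true_eq, List.toFinset_cons, List.toFinset_nil, insert_empty_eq]
    generalize (firstThresholds I R).val = r at *
    obtain ⟨M, E⟩ := r
    simp only at *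
    have hM1 : M ≤ I.f {v} → 0 ≤ I.f {v} ∧ (∀ u ∈ v :: R, I.f {u} ≤ I.f {v}) ∧
        (I.f {v} = 0 ∨ ∃ u ∈ v :: R, I.f {v} = I.f {u}) := by
      refine fun h => ⟨h2.trans h, ?_, Or.inr ⟨v, List.mem_cons_self, rfl⟩⟩
      rintro u hu
      rcases List.mem_cons.1 hu with rfl | hu
      · exact le_rfl
      · exact (h3 u hu).trans h
    have hM2 : ¬ M ≤ I.f {v} → 0 ≤ M ∧ (∀ u ∈ v :: R, I.f {u} ≤ M) ∧
        (M = 0 ∨ ∃ u ∈ v :: R, M = I.f {u}) := by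
      refine fun h => ⟨h2, ?_, ?_⟩
      · rintro u hu
        rcases List.mem_cons.1 hu with rfl | hu
        · exact (not_le.1 h).le
        · exact h3 u hu
      · exact h4.imp_right fun ⟨u, hu, e⟩ => ⟨u, List.mem_cons_of_mem _ hu, e⟩
    have hmem := h1.mem_iff
    simp only [Nat.lt_one_iff, exists_eq_left, pow_zero, mul_one] at hmem
    have hE1 : 0 < I.f {v} →
        IsThresholds I (v :: R) δ 1 (insertDesc (I.f {v} / I.c v, v) E).val := by
      intro hv
      have hp := insertDesc_perm (I.f {v} / I.c v, v) E
      refine ⟨h1.desc.insertDesc _, ?_, fun x => ?_⟩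
      · rw [hp.length_eq]
        simpa using h1.length_le
      · rw [hp.mem_iff, List.mem_cons, hmem, List.mem_cons]
        simp only [Nat.lt_one_iff, exists_eq_left, pow_zero, mul_one]
        constructor
        · rintro (rfl | h)
          · exact ⟨Or.inl rfl, hv, rfl⟩
          · exact ⟨Or.inr h.1, h.2⟩
        · rintro ⟨h | h, hx⟩
          · left
            obtain ⟨x1, x2⟩ := x
            simp only at h hx
            subst h
            rw [hx.2]
          · exact Or.inr ⟨h, hx⟩
    have hE2 : ¬ 0 < I.f {v} → IsThresholds I (v :: R) δ 1 E := by
      refine fun hv => ⟨h1.desc, h1.length_le.trans (by simp), fun x => ?_⟩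
      rw [hmem, List.mem_cons]
      simp only [Nat.lt_one_iff, exists_eq_left, pow_zero, mul_one]
      constructor
      · exact fun h => ⟨Or.inr h.1, h.2⟩
      · rintro ⟨h | h, hx⟩
        · exact absurd (h ▸ hx.1) hv
        · exact ⟨h, hx⟩
    split_ifs with hv h h
    · exact ⟨hE1 hv, hM1 h⟩
    · exact ⟨hE1 hv, hM2 h⟩
    · exact ⟨hE2 hv, hM1 h⟩
    · exact ⟨hE2 hv, hM2 h⟩

theorem time_firstThresholds_le (I : Inst V) {N : ℕ} (l : List V) (hl : l.length ≤ N) :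
    (firstThresholds I l).time ≤ (2 * N + 9) * l.length + 1 := by
  induction l with
  | nil => simp [firstThresholds]
  | cons v R ih =>
    rw [List.length_cons] at hl
    have h1 := ih (by omega)
    have h2 := (firstThresholds_spec I 0 R).1.length_le
    rw [mul_one] at h2
    simp only [firstThresholds, Timed.time_bind, op_bind, eval_bind, Timed.time_tick,
      List.length_cons, mul_add_one]
    have := time_insertDesc_le (I.f [v].toFinset / I.c v, v) (firstThresholds I R).val.2
    split_ifs <;> simp only [Timed.time_bind, Timed.time_tick, time_op] <;> omega

theorem IsThresholds.double {W : Type} {I : Inst W} {l : List W} {δ : ℝ} {m : ℕ}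
    {E : List (ℝ × W)}
    (h : IsThresholds I l δ m E) (hδ : δ ≤ 1) :
    IsThresholds I l δ (m + m) (merge E (scale ((1 - δ) ^ m) E).val).val := by
  have hp := merge_perm E (scale ((1 - δ) ^ m) E).val
  have hq : 0 ≤ (1 - δ) ^ m := pow_nonneg (by linarith) m
  rw [val_scale] at *
  refine ⟨h.desc.merge (h.desc.map _ fun x y hxy => mul_le_mul_of_nonneg_left hxy hq), ?_, ?_⟩
  · rw [hp.length_eq, List.length_append, List.length_map, mul_add]
    exact add_le_add h.length_le h.length_le
  · intro x
    rw [hp.mem_iff, List.mem_append, h.mem_iff, List.mem_map]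
    constructor
    · rintro (⟨h1, h2, j, hj, e⟩ | ⟨z, hz, rfl⟩)
      · exact ⟨h1, h2, j, by omega, e⟩
      · obtain ⟨h1, h2, j, hj, e⟩ := (h.mem_iff z).1 hz
        refine ⟨h1, h2, m + j, by omega, ?_⟩
        simp only [e, pow_add]
        ring
    · rintro ⟨h1, h2, j, hj, e⟩
      rcases lt_or_ge j m with hjm | hjm
      · exact Or.inl ⟨h1, h2, j, hjm, e⟩
      · right
        refine ⟨(I.f {x.2} / I.c x.2 * (1 - δ) ^ (j - m), x.2),
          (h.mem_iff _).2 ⟨h1, h2, j - m, by omega, rfl⟩, Prod.ext ?_ rfl⟩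
        simp only [e]
        rw [mul_left_comm, ← pow_add, Nat.add_sub_cancel' hjm]

/-- Going from `m` to `2 * m` thresholds costs at most `(6 * l.length + 4) * m` steps, so the costs
telescope. The last doubling was still needed, so its starting factor exceeds `t`. Without a regular
stop, `m` has been doubled `k` times. -/
theorem allThresholds_spec {W : Type} {I : Inst W} {l : List W} {δ t : ℝ} (hδ : δ ≤ 1) (k : ℕ) {m : ℕ}
    (hm : 1 ≤ m) {E : List (ℝ × W)} (h : IsThresholds I l δ m E) :
    ∃ m', m ≤ m' ∧ IsThresholds I l δ m' (allThresholds t k ((1 - δ) ^ m) E).val ∧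
      (allThresholds t k ((1 - δ) ^ m) E).time + (6 * l.length + 4) * m ≤
        (6 * l.length + 4) * m' + 2 ∧
      (m' = m ∨ ∃ i, m' = i + i ∧ t < (1 - δ) ^ i) ∧
      ((1 - δ) ^ m' ≤ t ∨ m * 2 ^ k ≤ m') := by
  induction k generalizing m E with
  | zero => exact ⟨m, le_rfl, h, by simp [allThresholds, add_comm], Or.inl rfl, by simp⟩
  | succ k ih =>
    simp only [allThresholds, op_bind, Timed.val_tick, Timed.time_tick, decide_eq_true_eq]
    split_ifs with hq
    · exact ⟨m, le_rfl, h, by simp only [time_op]; omega, Or.inl rfl, Or.inl hq⟩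
    · simp only [Timed.val_bind, Timed.val_tick, Timed.time_bind, Timed.time_tick, ← pow_add]
      obtain ⟨m', h1, h2, h3, h4, h5⟩ := ih (m := m + m) (by omega) (h.double hδ)
      refine ⟨m', by omega, h2, ?_, ?_, ?_⟩
      · have hs := time_scale ((1 - δ) ^ m) E
        have hmg := time_merge_le E (scale ((1 - δ) ^ m) E).val
        have hlen : (scale ((1 - δ) ^ m) E).val.length = E.length := by simp [val_scale]
        have hE := h.length_le
        have e : (6 * l.length + 4) * (m + m) =
          (6 * l.length + 4) * m + 6 * (l.length * m) + 4 * m := by ring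
        omega
      · right
        rcases h4 with h4 | h4
        · exact ⟨m, h4, not_le.1 hq⟩
        · exact h4
      · exact h5.imp_right fun h5 => le_trans (le_of_eq (by ring)) h5

/-! ### The records kept by the variant with thresholding -/

/-- `b` is a feasible solution together with its value. -/
def IsRecord (I : Inst V) (b : ℝ × List V) : Prop :=
  b.1 = I.f b.2.toFinset ∧ I.Feasible b.2.toFinset

theorem IsRecord.record {I : Inst V} {b : ℝ × List V} (hb : IsRecord I b) {a : ℝ} {S : List V}
    (h : IsRecord I (a, S)) : IsRecord I (record b a S).val := by
  rw [val_record]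
  split_ifs
  · exact h
  · exact hb

theorem le_record {W : Type} (b : ℝ × List W) (a : ℝ) (S : List W) :
    b.1 ≤ (record b a S).val.1 ∧ a ≤ (record b a S).val.1 := by
  rw [val_record]
  split_ifs with h
  · exact ⟨h, le_rfl⟩
  · exact ⟨le_rfl, (not_le.1 h).le⟩

theorem le_augment (I : Inst V) (S : List V) (κ : ℝ) (R : List V) (b : ℝ × List V) :
    b.1 ≤ (augment I S κ R b).val.1 ∧
    ∀ v ∈ R, κ + I.c v ≤ I.B → I.f (insert v S.toFinset) ≤ (augment I S κ R b).val.1 := by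
  induction R generalizing b with
  | nil => simp [augment]
  | cons v R ih =>
    simp only [augment, op_bind, eval_bind, Timed.val_tick, decide_eq_true_eq, List.toFinset_cons]
    split_ifs with h
    · simp only [Timed.val_tick, Timed.val_bind]
      have h1 := le_record b (I.f (insert v S.toFinset)) (v :: S)
      have h2 := ih (record b (I.f (insert v S.toFinset)) (v :: S)).val
      refine ⟨h1.1.trans h2.1, fun u hu hfit => ?_⟩
      rcases List.mem_cons.1 hu with rfl | hu
      · exact h1.2.trans h2.1
      · exact h2.2 u hu hfit
    · refine ⟨(ih b).1, fun u hu hfit => ?_⟩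
      rcases List.mem_cons.1 hu with rfl | hu
      · exact absurd hfit h
      · exact (ih b).2 u hu hfit

/-- Here `v` may already lie in `S`, so `κ` is only assumed to bound the cost from above;
feasibility then needs no information about the thresholds. -/
theorem IsRecord.cons {I : Inst V} (hI : I.IsBSM) {S : List V} (hS : S.toFinset ⊆ I.ground)
    {κ : ℝ} (hκ : I.cost S.toFinset ≤ κ) {v : V} (hv : v ∈ I.ground) (hfit : κ + I.c v ≤ I.B) :
    IsRecord I (I.f (insert v S.toFinset), v :: S) := by
  refine ⟨by simp, ?_⟩
  simp only [List.toFinset_cons]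
  exact ⟨Finset.insert_subset hv hS, (hI.cost_insert_le hv).trans (by linarith)⟩

theorem IsRecord.augment {I : Inst V} (hI : I.IsBSM) {S : List V} (hS : S.toFinset ⊆ I.ground)
    {κ : ℝ} (hκ : I.cost S.toFinset ≤ κ) {R : List V} (hR : ∀ v ∈ R, v ∈ I.ground)
    {b : ℝ × List V} (hb : IsRecord I b) : IsRecord I (augment I S κ R b).val := by
  induction R generalizing b with
  | nil => exact hb
  | cons v R ih =>
    have hR' : ∀ u ∈ R, u ∈ I.ground := fun u hu => hR u (List.mem_cons_of_mem _ hu)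
    simp only [BSM.augment, op_bind, eval_bind, Timed.val_tick, decide_eq_true_eq,
      List.toFinset_cons]
    split_ifs with h
    · exact ih hR' (hb.record (IsRecord.cons hI hS hκ (hR v List.mem_cons_self) h))
    · exact ih hR' hb

theorem time_augment_le (I : Inst V) (S : List V) (κ : ℝ) (R : List V) (b : ℝ × List V) :
    (augment I S κ R b).time ≤ 7 * R.length + 1 := by
  induction R generalizing b with
  | nil => simp [augment]
  | cons v R ih =>
    simp only [augment, op_bind, eval_bind, Timed.time_tick, decide_eq_true_eq, List.length_cons]
    split_ifs with h
    · simp only [Timed.time_tick, Timed.time_bind, time_record]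
      have := ih (record b (I.f (v :: S).toFinset) (v :: S)).val
      omega
    · have := ih b
      omega

/-- One pair visited by the loop: the three possible outcomes. -/
theorem thresholdLoop_cons (I : Inst V) (l : List V) (δ M : ℝ) (x : ℝ × V) (E : List (ℝ × V))
    (S : List V) (κ a z : ℝ) (b : ℝ × List V) :
    (¬ (κ + I.c x.2 ≤ I.B ∧ x.1 * I.c x.2 ≤ I.f (insert x.2 S.toFinset) - a) ∧
      (thresholdLoop I l δ M (x :: E) S κ a z b).val = (thresholdLoop I l δ M E S κ a z b).val ∧
      (thresholdLoop I l δ M (x :: E) S κ a z b).time ≤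
        14 + (thresholdLoop I l δ M E S κ a z b).time) ∨
    ((κ + I.c x.2 ≤ I.B ∧ x.1 * I.c x.2 ≤ I.f (insert x.2 S.toFinset) - a) ∧
      ∃ z' b'', ((z' = I.f (insert x.2 S.toFinset) ∧
          z + δ * (z + M) < I.f (insert x.2 S.toFinset) ∧
          b'' = (augment I (x.2 :: S) (κ + I.c x.2) l
            (record b (I.f (insert x.2 S.toFinset)) (x.2 :: S)).val).val ∧
          (thresholdLoop I l δ M (x :: E) S κ a z b).time ≤ 14 + (7 * l.length + 1) +
            (thresholdLoop I l δ M E (x.2 :: S) (κ + I.c x.2)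
              (I.f (insert x.2 S.toFinset)) z' b'').time) ∨
        (z' = z ∧ I.f (insert x.2 S.toFinset) ≤ z + δ * (z + M) ∧
          b'' = (record b (I.f (insert x.2 S.toFinset)) (x.2 :: S)).val ∧
          (thresholdLoop I l δ M (x :: E) S κ a z b).time ≤ 14 +
            (thresholdLoop I l δ M E (x.2 :: S) (κ + I.c x.2)
              (I.f (insert x.2 S.toFinset)) z' b'').time)) ∧
      (thresholdLoop I l δ M (x :: E) S κ a z b).val = (thresholdLoop I l δ M E (x.2 :: S)
        (κ + I.c x.2) (I.f (insert x.2 S.toFinset)) z' b'').val) := by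
  generalize hL : thresholdLoop I l δ M (x :: E) S κ a z b = L
  simp only [thresholdLoop, op_bind, eval_bind, decide_eq_true_eq, List.toFinset_cons] at hL
  by_cases h1 : κ + I.c x.2 ≤ I.B
  · rw [if_pos h1] at hL
    by_cases h2 : x.1 * I.c x.2 ≤ I.f (insert x.2 S.toFinset) - a
    · rw [if_pos h2] at hL
      refine Or.inr ⟨⟨h1, h2⟩, ?_⟩
      by_cases h3 : z + δ * (z + M) < I.f (insert x.2 S.toFinset)
      · simp only [if_pos h3] at hL
        subst hL
        refine ⟨_, _, Or.inl ⟨rfl, h3, rfl, ?_⟩, rfl⟩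
        simp only [Timed.time_tick, Timed.time_bind, time_record]
        have := time_augment_le I (x.2 :: S) (κ + I.c x.2) l
          (record b (I.f (insert x.2 S.toFinset)) (x.2 :: S)).val
        omega
      · simp only [if_neg h3] at hL
        subst hL
        refine ⟨_, _, Or.inr ⟨rfl, not_lt.1 h3, rfl, ?_⟩, rfl⟩
        simp only [Timed.time_tick, Timed.time_bind, time_record]
        omega
    · rw [if_neg h2] at hL
      subst hL
      refine Or.inl ⟨fun h => h2 h.2, rfl, ?_⟩
      simp only [Timed.time_tick]
      omega
  · rw [if_neg h1] at hL
    subst hL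
    refine Or.inl ⟨fun h => h1 h.1, rfl, ?_⟩
    simp only [Timed.time_tick]
    omega

theorem le_thresholdLoop (I : Inst V) (l : List V) (δ M : ℝ) (E : List (ℝ × V)) (S : List V)
    (κ a z : ℝ) (b : ℝ × List V) : b.1 ≤ (thresholdLoop I l δ M E S κ a z b).val.1 := by
  induction E generalizing S κ a z b with
  | nil => exact le_rfl
  | cons x E ih =>
    rcases thresholdLoop_cons I l δ M x E S κ a z b with ⟨-, h, -⟩ | ⟨-, z', b'', hb, h⟩
    · rw [h]
      exact ih ..
    · rw [h]
      refine le_trans ?_ (ih ..)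
      refine (le_record b (I.f (insert x.2 S.toFinset)) (x.2 :: S)).1.trans ?_
      rcases hb with ⟨-, -, rfl, -⟩ | ⟨-, -, rfl, -⟩
      · exact (le_augment ..).1
      · exact le_rfl

theorem IsRecord.thresholdLoop {I : Inst V} (hI : I.IsBSM) {l : List V}
    (hl : ∀ v ∈ l, v ∈ I.ground) {δ M : ℝ} {E : List (ℝ × V)} (hE : ∀ x ∈ E, x.2 ∈ I.ground)
    {S : List V} (hS : S.toFinset ⊆ I.ground) {κ a z : ℝ} (hκ : I.cost S.toFinset ≤ κ)
    {b : ℝ × List V} (hb : IsRecord I b) :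
    IsRecord I (thresholdLoop I l δ M E S κ a z b).val := by
  induction E generalizing S κ a z b with
  | nil => exact hb
  | cons x E ih =>
    have hE' : ∀ x ∈ E, x.2 ∈ I.ground := fun w hw => hE w (List.mem_cons_of_mem _ hw)
    have hx := hE x List.mem_cons_self
    rcases thresholdLoop_cons I l δ M x E S κ a z b with ⟨-, h, -⟩ | ⟨hfit, z', b'', hb'', h⟩
    · rw [h]
      exact ih hE' hS hκ hb
    · rw [h]
      have hS' : (x.2 :: S).toFinset ⊆ I.ground := by
        rw [List.toFinset_cons]
        exact Finset.insert_subset hx hS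
      have hκ' : I.cost (x.2 :: S).toFinset ≤ κ + I.c x.2 := by
        rw [List.toFinset_cons]
        exact (hI.cost_insert_le hx).trans (by linarith)
      refine ih hE' hS' hκ' ?_
      have hr := hb.record (IsRecord.cons hI hS hκ hx hfit.1)
      rcases hb'' with ⟨-, -, rfl, -⟩ | ⟨-, -, rfl, -⟩
      · exact hr.augment hI hS' hκ' hl
      · exact hr

/-! ### The approximation ratio of the variant with thresholding -/

/-- The thresholds in `E` are positive, and for each of them the next one, smaller by a factor
`1 - δ`, is also in `E` or negligible. -/
def NextClosed (I : Inst V) (δ : ℝ) (E : List (ℝ × V)) : Prop :=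
  ∀ x ∈ E, 0 < x.1 ∧ x.2 ∈ I.ground ∧ (((1 - δ) * x.1, x.2) ∈ E ∨
    (1 - δ) * x.1 * I.c x.2 ≤ δ / I.ground.card * I.f {x.2})

/-- Every element that fits has a marginal value that is negligible or bounded by one of its
remaining thresholds. -/
def Covered (I : Inst V) (δ : ℝ) (E : List (ℝ × V)) (S : Finset V) : Prop :=
  ∀ u ∈ I.ground, I.cost S + I.c u ≤ I.B →
    (∃ x ∈ E, x.2 = u ∧ (1 - δ) * (I.f (insert u S) - I.f S) ≤ x.1 * I.c u) ∨
    (1 - δ) * (I.f (insert u S) - I.f S) ≤ δ / I.ground.card * I.f {u}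

/-- The removed head has the largest threshold, so it is not the strictly smaller successor of a
remaining pair. -/
theorem NextClosed.tail {W : Type} {I : Inst W} {δ : ℝ} (hδ : 0 < δ) {x : ℝ × W}
    {E : List (ℝ × W)} (hd : Desc (x :: E)) (h : NextClosed I δ (x :: E)) : NextClosed I δ E := by
  intro w hw
  obtain ⟨h1, h2, h3⟩ := h w (List.mem_cons_of_mem _ hw)
  refine ⟨h1, h2, h3.imp_left fun h3 => ?_⟩
  rcases List.mem_cons.1 h3 with h4 | h4
  · have := (List.pairwise_cons.1 hd).1 w hw
    rw [← h4] at this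
    simp only at this
    nlinarith
  · exact h4

theorem small_nonneg {I : Inst V} (hI : I.IsBSM) {δ : ℝ} (hδ : 0 ≤ δ) {u : V}
    (hu : u ∈ I.ground) : 0 ≤ δ / I.ground.card * I.f {u} := by
  have := hI.nonneg {u} (by simpa using hu)
  positivity

/-- A fitting element that is rejected has marginal value below its threshold, so `1 - δ` times that
value is below its next threshold. -/
theorem Covered.skip {I : Inst V} {δ : ℝ} {x : ℝ × V} {E : List (ℝ × V)} {S : Finset V}
    (h : Covered I δ (x :: E) S) (hN : NextClosed I δ (x :: E)) (hδ : 0 < δ) (hδ1 : δ ≤ 1)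
    (hx : ¬ (I.cost S + I.c x.2 ≤ I.B ∧ x.1 * I.c x.2 ≤ I.f (insert x.2 S) - I.f S)) :
    Covered I δ E S := by
  intro u hu hfit
  rcases h u hu hfit with ⟨w, hw, rfl, hle⟩ | h
  · rcases List.mem_cons.1 hw with rfl | hw
    · have hlt : I.f (insert w.2 S) - I.f S < w.1 * I.c w.2 := by
        by_contra! hge
        exact hx ⟨hfit, hge⟩
      have hle' : (1 - δ) * (I.f (insert w.2 S) - I.f S) ≤ (1 - δ) * w.1 * I.c w.2 := by
        rw [mul_assoc]
        exact mul_le_mul_of_nonneg_left hlt.le (by linarith)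
      obtain ⟨h1, h2, h3 | h3⟩ := hN w List.mem_cons_self
      · rcases List.mem_cons.1 h3 with h4 | h4
        · have := congrArg Prod.fst h4
          simp only at this
          nlinarith
        · exact Or.inl ⟨_, h4, rfl, hle'⟩
      · exact Or.inr (hle'.trans h3)
    · exact Or.inl ⟨w, hw, rfl, hle⟩
  · exact Or.inr h

/-- Marginals only shrink and fewer elements fit. The added element loses its pair, but its marginal
is now zero. -/
theorem Covered.add {I : Inst V} (hI : I.IsBSM) {δ : ℝ} {x : ℝ × V} {E : List (ℝ × V)}
    {S : Finset V} (h : Covered I δ (x :: E) S) (hδ : 0 ≤ δ) (hδ1 : δ ≤ 1)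
    (hS : S ⊆ I.ground) (hx : x.2 ∈ I.ground) : Covered I δ E (insert x.2 S) := by
  intro u hu hfit
  have hS' := Finset.insert_subset hx hS
  have hc := hI.cost_mono (Finset.subset_insert x.2 S) hS'
  have hm := mul_le_mul_of_nonneg_left
    (hI.marginal_anti (Finset.subset_insert x.2 S) hS' hu) (show 0 ≤ 1 - δ by linarith)
  rcases h u hu (by linarith) with ⟨w, hw, rfl, hle⟩ | h
  · rcases List.mem_cons.1 hw with rfl | hw
    · right
      rw [Finset.insert_eq_of_mem (Finset.mem_insert_self _ _), sub_self, mul_zero]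
      exact small_nonneg hI hδ hu
    · exact Or.inl ⟨w, hw, rfl, hm.trans hle⟩
  · exact Or.inr (hm.trans h)

/-- When the list is exhausted and `r` still fits, all of `O` is negligible over `S`. This yields
`(1 - δ) * f O ≤ A`, far above the assumed bound on `A`. -/
theorem Inst.IsSplit.false_of_covered_nil {I : Inst V} (hI : I.IsBSM) {O : Finset V} {y r : V}
    (hO : I.IsSplit O y r) {δ A : ℝ} (hδ0 : 0 ≤ δ) (hδ1 : δ ≤ 1 / 16) (hF : 0 < I.f O)
    (hA : I.f {y} ≤ A) (hAF : A < (1 - 16 * δ) * (1 - gap) * I.f O) {S : Finset V}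
    (hS : S ⊆ I.ground) (hyS : y ∈ S) (hSA : I.f S ≤ A) (hfit : I.cost S + I.c r ≤ I.B)
    (hcov : Covered I δ [] S) : False := by
  have hyg := hO.sub hO.memy
  have hn : 0 < (I.ground.card : ℝ) := Nat.cast_pos.2 (Finset.card_pos.2 ⟨y, hyg⟩)
  have ha0 : 0 ≤ I.f {y} := hI.nonneg _ (by simpa using hyg)
  have h1 : I.f O ≤ I.f S + ∑ u ∈ O, (I.f (insert u S) - I.f S) :=
    (hI.mono _ _ Finset.subset_union_right (Finset.union_subset hS hO.sub)).trans
      (hI.union_le_add_sum hS hO.sub)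
  have h2 : ∑ u ∈ O, (1 - δ) * (I.f (insert u S) - I.f S) ≤
      ∑ _u ∈ O, δ / I.ground.card * I.f {y} := by
    refine Finset.sum_le_sum fun u hu => ?_
    have h3 : δ / I.ground.card * I.f {u} ≤ δ / I.ground.card * I.f {y} :=
      mul_le_mul_of_nonneg_left (hO.le_single u hu) (by positivity)
    refine le_trans ?_ h3
    by_cases huy : u = y
    · subst huy
      rw [Finset.insert_eq_of_mem hyS, sub_self, mul_zero]
      exact small_nonneg hI hδ0 hyg
    · rcases hcov u (hO.sub hu) (by linarith [hO.cost_le_r u hu huy]) with ⟨w, hw, -⟩ | h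
      · simp at hw
      · exact h
  rw [← Finset.mul_sum, Finset.sum_const, nsmul_eq_mul] at h2
  have h3 : O.card * (δ / I.ground.card * I.f {y}) ≤ δ * I.f {y} := by
    have : (O.card : ℝ) ≤ I.ground.card := Nat.cast_le.2 (Finset.card_le_card hO.sub)
    calc O.card * (δ / I.ground.card * I.f {y})
        ≤ I.ground.card * (δ / I.ground.card * I.f {y}) := by gcongr
      _ = δ * I.f {y} := by field_simp
  have h4 : (1 - δ) * I.f O ≤ (1 - δ) * A + δ * A := by
    have h5 := mul_le_mul_of_nonneg_left h1 (show 0 ≤ 1 - δ by linarith)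
    have h6 := mul_le_mul_of_nonneg_left hSA (show 0 ≤ 1 - δ by linarith)
    have h7 := mul_le_mul_of_nonneg_left hA hδ0
    linarith
  have h8 : (1 - 16 * δ) * (1 - gap) * I.f O ≤ 1 * (1 - gap) * I.f O := by
    have : 0 ≤ 1 - gap := by linarith [gap_lt]
    gcongr
    linarith
  nlinarith [gap_gt]

/-- The hypotheses on `z` are the loop invariant: when the solution had value `z`, its augmentation
by `r` was recorded, so `r` added at most `A - z`, and the value has grown by at most `δ * (z + M)`
since. -/
theorem Inst.IsSplit.false_of_thresholdLoop_le {I : Inst V} (hI : I.IsBSM) {O : Finset V}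
    {y r : V} (hO : I.IsSplit O y r) {l : List V} (hl : ∀ v ∈ I.ground, v ∈ l) {δ M A : ℝ}
    (hδ0 : 0 < δ) (hδ1 : δ ≤ 1 / 16) (hM0 : 0 ≤ M) (hM : M ≤ A) (hF : 0 < I.f O)
    (hA : I.f {y} ≤ A)     (hAF : A < (1 - 16 * δ) * (1 - gap) * I.f O) {E : List (ℝ × V)} (hd : Desc E)
    (hN : NextClosed I δ E) {S : List V} (hS : S.toFinset ⊆ I.ground) (hyS : y ∈ S.toFinset)
    {κ a z : ℝ} (hκ : κ = I.cost S.toFinset) (ha : a = I.f S.toFinset)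
    (hfit : I.cost S.toFinset + I.c r ≤ I.B) (hSA : a ≤ A) (hcov : Covered I δ E S.toFinset)
    (hzA : z ≤ A) (haz : a ≤ z + δ * (z + M))
    (hr : I.f (insert r S.toFinset) - a ≤ A - z)
    (htlog : tlog (I.missing O y S.toFinset) ≤ tlog (I.missing O y {y}) -
        (1 - δ / gap) * ((I.cost S.toFinset - I.c y) / I.room y r)) {b : ℝ × List V}
    (hle : (thresholdLoop I l δ M E S κ a z b).val.1 ≤ A) : False := by
  induction E generalizing S κ a z b with
  | nil =>
    exact hO.false_of_covered_nil hI hδ0.le hδ1 hF hA hAF hS hyS (ha ▸ hSA) hfit hcov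
  | cons x E ih =>
    subst hκ ha
    have hxd := (List.pairwise_cons.1 hd).1
    have hd' : Desc E := (List.pairwise_cons.1 hd).2
    have hN' := hN.tail hδ0 hd
    obtain ⟨hx0, hxg, -⟩ := hN x List.mem_cons_self
    rcases thresholdLoop_cons I l δ M x E S (I.cost S.toFinset) (I.f S.toFinset) z b with
      ⟨hx, h, -⟩ | ⟨⟨hxfit, hxdense⟩, z', b'', hb, h⟩
    · rw [h] at hle
      exact ih hd' hN' hS hyS rfl rfl hfit hSA (hcov.skip hN hδ0 (by linarith) hx) hzA haz hr
        htlog hle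
    · rw [h] at hle
      have hxc := hI.cost_pos _ hxg
      have hrg := hO.sub hO.memr
      -- A positive threshold prevents an element from being added twice, so the tracked cost is
      -- exact.
      have hxS : x.2 ∉ S.toFinset := fun hxS => by
        rw [Finset.insert_eq_of_mem hxS, sub_self] at hxdense
        nlinarith
      have hS' : insert x.2 S.toFinset ⊆ I.ground := Finset.insert_subset hxg hS
      have hbA := (le_thresholdLoop I l δ M E (x.2 :: S) (I.cost S.toFinset + I.c x.2)
        (I.f (insert x.2 S.toFinset)) z' b'').trans hle
      have hSA' : I.f (insert x.2 S.toFinset) ≤ A := by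
        refine (le_record b (I.f (insert x.2 S.toFinset)) (x.2 :: S)).2.trans (le_trans ?_ hbA)
        rcases hb with ⟨-, -, rfl, -⟩ | ⟨-, -, rfl, -⟩
        · exact (le_augment ..).1
        · exact le_rfl
      obtain ⟨hX, hstep⟩ := hO.tlog_missing_step hI (δ := δ) (A := A) (θ := x.1)
        (S := S.toFinset) (S' := insert x.2 S.toFinset) (v := x.2) hδ0.le hδ1 hS hyS hF hA hAF.le
        -- `f (S ∪ {r}) ≤ A + (a - z) ≤ A + δ * (z + M)`, with `z` and `M` at most `A`.
        (by nlinarith) hx0.le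
        (by
          intro u hu huy
          have huc := hI.cost_pos u (hO.sub hu)
          have hs := small_nonneg hI hδ0.le (hO.sub hu)
          rcases hcov u (hO.sub hu) (by linarith [hO.cost_le_r u hu huy]) with
            ⟨w, hw, -, hle⟩ | h
          · have hwx : w.1 ≤ x.1 := by
              rcases List.mem_cons.1 hw with rfl | hw
              · exact le_rfl
              · exact hxd w hw
            have := mul_le_mul_of_nonneg_right hwx huc.le
            linarith
          · have := mul_nonneg hx0.le huc.le
            linarith)
        hxc.le hxdense
      have hc := I.cost_insert hxS
      have htlog' : tlog (I.missing O y (insert x.2 S.toFinset)) ≤ tlog (I.missing O y {y}) -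
          (1 - δ / gap) * ((I.cost (insert x.2 S.toFinset) - I.c y) / I.room y r) := by
        rw [hc, show I.cost S.toFinset + I.c x.2 - I.c y =
          (I.cost S.toFinset - I.c y) + I.c x.2 by ring, add_div]
        linarith
      by_cases hfit' : I.cost (insert x.2 S.toFinset) + I.c r ≤ I.B
      · have hfin := List.toFinset_cons (a := x.2) (l := S)
        have key : z' ≤ A ∧ I.f (insert x.2 S.toFinset) ≤ z' + δ * (z' + M) ∧
            I.f (insert r (insert x.2 S.toFinset)) - I.f (insert x.2 S.toFinset) ≤ A - z' := by
          -- Either the augmentation by `r` has just been recorded again, or the old bound on its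
          -- marginal persists by submodularity.
          rcases hb with ⟨rfl, hgrown, rfl, -⟩ | ⟨rfl, hsmall, rfl, -⟩
          · refine ⟨hSA', ?_, ?_⟩
            · have h0 := hI.nonneg _ hS'
              have := mul_nonneg hδ0.le (add_nonneg h0 hM0)
              linarith
            · have := ((le_augment I (x.2 :: S) (I.cost S.toFinset + I.c x.2) l
                (record b (I.f (insert x.2 S.toFinset)) (x.2 :: S)).val).2 r (hl r hrg)
                (by linarith)).trans hbA
              rw [hfin] at this
              linarith
          · refine ⟨hzA, hsmall, ?_⟩
            exact (hI.marginal_anti (Finset.subset_insert x.2 S.toFinset) hS' hrg).trans hr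
        rw [← hfin] at hS' hc hSA' hfit' htlog' key hle
        exact ih hd' hN' hS' (by rw [hfin]; exact Finset.mem_insert_of_mem hyS)
          hc.symm rfl hfit' hSA' (by rw [hfin]; exact hcov.add hI hδ0.le (by linarith) hS hxg)
          key.1 key.2.1 key.2.2 htlog' hle
      · refine hO.false_of_room_lt hI hδ0.le hδ1 hF (hSA'.trans_lt hAF) hX ?_ htlog'
        unfold Inst.room
        linarith

/-! ### The running time of the variant with thresholding -/

theorem Inst.IsBSM.le_of_single_le {I : Inst V} (hI : I.IsBSM) {M : ℝ}
    (hM : ∀ v ∈ I.ground, I.f {v} ≤ M) (hne : I.ground.Nonempty) {S : Finset V}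
    (hS : S ⊆ I.ground) : I.f S ≤ (I.ground.card + 1) * M := by
  obtain ⟨w, hw⟩ := hne
  have h0 : I.f ∅ ≤ M := (hI.mono _ _ (Finset.empty_subset _) (by simpa using hw)).trans (hM w hw)
  have hM0 : 0 ≤ M := (hI.nonneg {w} (by simpa using hw)).trans (hM w hw)
  have h1 := hI.union_le_add_sum (Finset.empty_subset I.ground) hS
  rw [Finset.empty_union] at h1
  have h2 : ∑ u ∈ S, (I.f (insert u ∅) - I.f ∅) ≤ ∑ _u ∈ S, M := by
    refine Finset.sum_le_sum fun u hu => ?_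
    have := hI.nonneg ∅ (Finset.empty_subset _)
    have := hM u (hS hu)
    simp only [insert_empty_eq]
    linarith
  rw [Finset.sum_const, nsmul_eq_mul] at h2
  have h3 : (S.card : ℝ) * M ≤ I.ground.card * M :=
    mul_le_mul_of_nonneg_right (Nat.cast_le.2 (Finset.card_le_card hS)) hM0
  linarith

/-- Each augmentation pass multiplies `z + M` by at least `1 + δ`, which bounds their number by a
logarithm. Adding `M` keeps the ratio bounded when the guess has value near zero. -/
theorem time_thresholdLoop_le {I : Inst V} (l : List V) {δ M N : ℝ} (hδ : 0 < δ) (hM : 0 < M)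
    (hN : ∀ S ⊆ I.ground, I.f S ≤ N) (hI : ∀ S ⊆ I.ground, 0 ≤ I.f S) {E : List (ℝ × V)}
    (hE : ∀ x ∈ E, x.2 ∈ I.ground) {S : List V} (hS : S.toFinset ⊆ I.ground) (κ a : ℝ) {z : ℝ}
    (hz0 : 0 ≤ z) (hzN : z ≤ N) (b : ℝ × List V) :
    ((thresholdLoop I l δ M E S κ a z b).time : ℝ) ≤ 14 * E.length + 1 +
      (7 * l.length + 1) * (Real.log ((N + M) / (z + M)) / Real.log (1 + δ)) := by
  have hlog : 0 < Real.log (1 + δ) := Real.log_pos (by linarith)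
  have hpot : ∀ w, 0 ≤ w → w ≤ N → 0 ≤ Real.log ((N + M) / (w + M)) / Real.log (1 + δ) :=
    fun w h0 hw => div_nonneg (Real.log_nonneg (by
      rw [one_le_div (by linarith)]
      linarith)) hlog.le
  induction E generalizing S κ a z b with
  | nil =>
    have := hpot z hz0 hzN
    simp only [thresholdLoop, time_op, List.length_nil, Nat.cast_zero, Nat.cast_one]
    have : 0 ≤ (7 * (l.length : ℝ) + 1) *
      (Real.log ((N + M) / (z + M)) / Real.log (1 + δ)) := by positivity
    linarith
  | cons x E ih =>
    have hE' : ∀ x ∈ E, x.2 ∈ I.ground := fun w hw => hE w (List.mem_cons_of_mem _ hw)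
    have hS' : (x.2 :: S).toFinset ⊆ I.ground := by
      rw [List.toFinset_cons]
      exact Finset.insert_subset (hE x List.mem_cons_self) hS
    rw [List.length_cons, Nat.cast_add_one]
    rcases thresholdLoop_cons I l δ M x E S κ a z b with ⟨-, -, h⟩ | ⟨-, z', b'', hb'', -⟩
    · have h1 := ih hE' hS κ a hz0 hzN b
      have h2 : ((thresholdLoop I l δ M (x :: E) S κ a z b).time : ℝ) ≤
        14 + (thresholdLoop I l δ M E S κ a z b).time := by exact_mod_cast h
      linarith
    · rw [← List.toFinset_cons] at hb''
      have hf0 := hI _ hS'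
      have hfN := hN _ hS'
      rcases hb'' with ⟨rfl, hgrown, -, h⟩ | ⟨rfl, -, -, h⟩
      · have h1 := ih hE' hS' (κ + I.c x.2) (I.f (x.2 :: S).toFinset) hf0 hfN b''
        have h2 : ((thresholdLoop I l δ M (x :: E) S κ a z b).time : ℝ) ≤
          14 + (7 * l.length + 1) + (thresholdLoop I l δ M E (x.2 :: S) (κ + I.c x.2)
            (I.f (x.2 :: S).toFinset) (I.f (x.2 :: S).toFinset) b'').time := by exact_mod_cast h
        have h3 : Real.log ((N + M) / (I.f (x.2 :: S).toFinset + M)) / Real.log (1 + δ) ≤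
            Real.log ((N + M) / (z + M)) / Real.log (1 + δ) - 1 := by
          rw [div_le_iff₀ hlog, sub_mul, div_mul_cancel₀ _ hlog.ne', one_mul,
            Real.log_div (by linarith) (by linarith), Real.log_div (by linarith) (by linarith)]
          have h4 : Real.log ((1 + δ) * (z + M)) ≤ Real.log (I.f (x.2 :: S).toFinset + M) :=
            Real.log_le_log (by positivity) (by linarith)
          rw [Real.log_mul (by linarith) (by linarith)] at h4
          linarith
        have h5 := mul_le_mul_of_nonneg_left h3
          (show 0 ≤ 7 * (l.length : ℝ) + 1 by positivity)
        linarith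
      · have h1 := ih hE' hS' (κ + I.c x.2) (I.f (x.2 :: S).toFinset) hz0 hzN b''
        have h2 : ((thresholdLoop I l δ M (x :: E) S κ a z' b).time : ℝ) ≤
          14 + (thresholdLoop I l δ M E (x.2 :: S) (κ + I.c x.2)
            (I.f (x.2 :: S).toFinset) z' b'').time := by exact_mod_cast h
        linarith

/-- What the variant with thresholding finds for the guess `y`, with the steps spent. -/
noncomputable def thresholdRecord (I : Inst V) (l : List V) (δ M : ℝ) (E : List (ℝ × V)) (y : V) :
    Timed (ℝ × List V) :=
  thresholdLoop I l δ M E [y] (I.c y) (I.f {y}) (I.f {y})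
    (augment I [y] (I.c y) l (I.f {y}, [y])).val

theorem time_thresholdGuessLoop_le (I : Inst V) (l : List V) (δ M : ℝ) (E : List (ℝ × V))
    (G : List V) (b : ℝ × List V) {t : ℝ} (ht0 : 0 ≤ t)
    (ht : ∀ y ∈ G, ((thresholdRecord I l δ M E y).time : ℝ) ≤ t) :
    ((thresholdGuessLoop I l δ M E G b).time : ℝ) ≤ G.length * (7 * l.length + 6 + t) + 1 := by
  induction G generalizing b with
  | nil => simp [thresholdGuessLoop]
  | cons y G ih =>
    have ih := fun b => ih b fun u hu => ht u (List.mem_cons_of_mem _ hu)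
    have hy := ht y List.mem_cons_self
    rw [List.length_cons, Nat.cast_add_one, add_one_mul]
    simp only [thresholdGuessLoop, op_bind, eval_bind, Timed.time_tick, decide_eq_true_eq,
      List.toFinset_cons, List.toFinset_nil, insert_empty_eq]
    split_ifs
    · simp only [Timed.time_tick, Timed.time_bind, time_record]
      rw [← thresholdRecord]
      have h1 : ((augment I [y] (I.c y) l (I.f {y}, [y])).time : ℝ) ≤ 7 * l.length + 1 := by
        exact_mod_cast time_augment_le ..
      generalize record _ _ _ = r
      have h2 := ih r.val
      push_cast
      linarith
    · have h2 := ih b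
      have : (0 : ℝ) ≤ l.length := Nat.cast_nonneg _
      push_cast
      linarith

theorem thresholdGuessLoop_spec {I : Inst V} (hI : I.IsBSM) {l : List V}
    (hl : ∀ v ∈ l, v ∈ I.ground) {δ M : ℝ} {E : List (ℝ × V)} (hE : ∀ x ∈ E, x.2 ∈ I.ground)
    {G : List V} (hG : ∀ y ∈ G, y ∈ I.ground) {b : ℝ × List V} (hb : IsRecord I b) :
    IsRecord I (thresholdGuessLoop I l δ M E G b).val ∧
    b.1 ≤ (thresholdGuessLoop I l δ M E G b).val.1 ∧
    ∀ y ∈ G, (thresholdRecord I l δ M E y).val.1 ≤ (thresholdGuessLoop I l δ M E G b).val.1 := by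
  induction G generalizing b with
  | nil => exact ⟨hb, le_rfl, by simp⟩
  | cons y G ih =>
    have hy := hG y List.mem_cons_self
    have hyS : [y].toFinset ⊆ I.ground := by simpa using hy
    have hκ : I.cost [y].toFinset ≤ I.c y := by simp
    simp only [thresholdGuessLoop, op_bind, eval_bind, Timed.val_tick, decide_eq_true_eq,
      List.toFinset_cons, List.toFinset_nil, insert_empty_eq, if_pos (hI.cost_le y hy),
      Timed.val_bind]
    rw [← thresholdRecord]
    have hy0 : IsRecord I (I.f {y}, [y]) :=
      ⟨by simp, by simpa using hI.feasible_singleton hy⟩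
    have hr : IsRecord I (thresholdRecord I l δ M E y).val :=
      (hy0.augment hI hyS hκ hl).thresholdLoop hI hl hE hyS hκ
    have hle := le_record b (thresholdRecord I l δ M E y).val.1 (thresholdRecord I l δ M E y).val.2
    obtain ⟨h1, h2, h3⟩ := ih (fun u hu => hG u (List.mem_cons_of_mem _ hu)) (hb.record hr)
    refine ⟨h1, hle.1.trans h2, fun u hu => ?_⟩
    rcases List.mem_cons.1 hu with rfl | hu
    · exact hle.2.trans h2
    · exact h3 u hu

theorem single_le_thresholdRecord (I : Inst V) (l : List V) (δ M : ℝ) (E : List (ℝ × V)) (y : V) :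
    I.f {y} ≤ (thresholdRecord I l δ M E y).val.1 :=
  (le_augment I [y] (I.c y) l (I.f {y}, [y])).1.trans (le_thresholdLoop ..)

/-- Only the last threshold of an element lacks a successor, and there `(1 - δ) ^ m` makes it
negligible. -/
theorem IsThresholds.nextClosed {I : Inst V} (hI : I.IsBSM) {l : List V}
    (hl : ∀ v ∈ l, v ∈ I.ground) {δ : ℝ} (hδ : δ < 1) {m : ℕ} {E : List (ℝ × V)}
    (h : IsThresholds I l δ m E) (hm : (1 - δ) ^ m ≤ δ / I.ground.card) : NextClosed I δ E := by
  intro x hx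
  obtain ⟨h1, h2, j, hj, e⟩ := (h.mem_iff x).1 hx
  have hc := hI.cost_pos _ (hl _ h1)
  have hq : 0 < 1 - δ := by linarith
  refine ⟨by rw [e]; positivity, hl _ h1, ?_⟩
  rcases Nat.lt_or_ge (j + 1) m with hjm | hjm
  · refine Or.inl ((h.mem_iff _).2 ⟨h1, h2, j + 1, hjm, ?_⟩)
    simp only [e, pow_succ]
    ring
  · right
    have hjm : j + 1 = m := by omega
    rw [← hjm] at hm
    calc (1 - δ) * x.1 * I.c x.2 = (1 - δ) ^ (j + 1) * I.f {x.2} := by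
          rw [e]
          field_simp
          ring
      _ ≤ _ := mul_le_mul_of_nonneg_right hm h2.le

/-- The first threshold `f {u} / c u` bounds every density of `u`. -/
theorem IsThresholds.covered {I : Inst V} (hI : I.IsBSM) {l : List V}
    (hl : ∀ v ∈ I.ground, v ∈ l) {δ : ℝ} (hδ0 : 0 ≤ δ) {m : ℕ} (hm : 1 ≤ m) {E : List (ℝ × V)}
    (h : IsThresholds I l δ m E) {S : Finset V} (hS : S ⊆ I.ground) : Covered I δ E S := by
  intro u hu _
  have h1 := hI.le_insert hS hu
  have h2 := hI.marginal_le_single hS hu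
  have h3 : (1 - δ) * (I.f (insert u S) - I.f S) ≤ I.f {u} := by nlinarith
  have hc := hI.cost_pos u hu
  rcases (hI.nonneg {u} (by simpa using hu)).lt_or_eq with hpos | h0
  · refine Or.inl ⟨(I.f {u} / I.c u, u), (h.mem_iff _).2 ⟨hl u hu, hpos, 0, hm, by simp⟩, rfl, ?_⟩
    simp only
    rwa [div_mul_cancel₀ _ hc.ne']
  · exact Or.inr (h3.trans (h0 ▸ small_nonneg hI hδ0 hu))

theorem Inst.IsSplit.ratio_le_thresholdRecord {I : Inst V} (hI : I.IsBSM) {O : Finset V} {y r : V}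
    (hO : I.IsSplit O y r) {l : List V} (hl : ∀ v, v ∈ l ↔ v ∈ I.ground) {δ M A : ℝ}
    (hδ0 : 0 < δ) (hδ1 : δ ≤ 1 / 16) (hM0 : 0 ≤ M) (hM : M ≤ A) {m : ℕ} (hm1 : 1 ≤ m)
    (hm : (1 - δ) ^ m ≤ δ / I.ground.card) {E : List (ℝ × V)} (hE : IsThresholds I l δ m E)
    (hA : (thresholdRecord I l δ M E y).val.1 ≤ A) :
    (1 - 16 * δ) * (1 - gap) * I.f O ≤ A := by
  by_contra! hlt
  have hyg := hO.sub hO.memy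
  have hyS : [y].toFinset ⊆ I.ground := by simpa using hyg
  have hyA := (single_le_thresholdRecord I l δ M E y).trans hA
  have hy0 := hI.nonneg {y} (by simpa using hyg)
  have hF : 0 < I.f O := by
    have h1 : 0 < (1 - 16 * δ) * (1 - gap) * I.f O := by linarith
    exact pos_of_mul_pos_right h1 (mul_nonneg (by linarith) (by linarith [gap_lt]))
  have hfit : I.c y + I.c r ≤ I.B := by
    have hs : ({y, r} : Finset V) ⊆ O := by
      simp [Finset.insert_subset_iff, hO.memy, hO.memr]
    have h3 := hI.cost_mono hs hO.sub
    rw [I.cost_insert (by simp [hO.ne.symm]), I.cost_singleton] at h3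
    linarith [hO.cost_le]
  have hlst : [y].toFinset = {y} := by simp
  refine hO.false_of_thresholdLoop_le hI (fun v hv => (hl v).2 hv) hδ0 hδ1 hM0 hM hF hyA hlt
    hE.desc (hE.nextClosed hI (fun v hv => (hl v).1 hv) (by linarith) hm) hyS (by simp)
    (κ := I.c y) (a := I.f {y}) (z := I.f {y}) (by simp) (by simp) (by simpa using hfit) hyA
    (hE.covered hI (fun v hv => (hl v).2 hv) hδ0.le hm1 hyS) hyA ?_ ?_ ?_ hA
  · have := mul_nonneg hδ0.le (add_nonneg hy0 hM0)
    linarith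
  · have := ((le_augment I [y] (I.c y) l (I.f {y}, [y])).2 r ((hl r).2 (hO.sub hO.memr)) hfit).trans
      ((le_thresholdLoop I l δ M E [y] (I.c y) (I.f {y}) (I.f {y}) _).trans hA)
    linarith
  · rw [hlst, I.cost_singleton, sub_self, zero_div, mul_zero, sub_zero]

/-- The list of all thresholds that the algorithm computes. -/
theorem exists_allThresholds {W : Type} (I : Inst W) {l : List W} (hl : l ≠ []) {δ : ℝ} (hδ0 : 0 < δ)
    (hδ1 : δ < 1) {E : List (ℝ × W)} (hE : IsThresholds I l δ 1 E) :
    ∃ m, 1 ≤ m ∧ IsThresholds I l δ m (allThresholds (δ / l.length)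
        ⌈(l.length : ℝ) / δ ^ 2⌉₊ (1 - δ) E).val ∧
      (1 - δ) ^ m ≤ δ / l.length ∧ (m : ℝ) ≤ 1 + 2 * Real.log (l.length / δ) / δ ∧
      ((allThresholds (δ / l.length) ⌈(l.length : ℝ) / δ ^ 2⌉₊ (1 - δ) E).time : ℝ) ≤
        (6 * l.length + 4) * m + 2 := by
  have hn : 0 < (l.length : ℝ) := Nat.cast_pos.2 (List.length_pos_of_ne_nil hl)
  have hn1 : 1 ≤ (l.length : ℝ) := by exact_mod_cast List.length_pos_of_ne_nil hl
  have hlog : ∀ i : ℕ, (1 - δ) ^ i ≤ Real.exp (-(i * δ)) := fun i => by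
    rw [← mul_neg, Real.exp_nat_mul]
    exact pow_le_pow_left₀ (by linarith) (Real.one_sub_le_exp_neg δ) i
  have hlog0 : 0 ≤ Real.log (l.length / δ) :=
    Real.log_nonneg (by rw [one_le_div hδ0]; linarith)
  obtain ⟨m, h1, h2, h3, h4, h5⟩ := allThresholds_spec (t := δ / l.length) hδ1.le
    ⌈(l.length : ℝ) / δ ^ 2⌉₊ le_rfl hE
  rw [pow_one] at h2 h3
  refine ⟨m, h1, h2, ?_, ?_, ?_⟩
  · rcases h5 with h5 | h5
    · exact h5
    -- Even if the round bound were exhausted, `m ≥ 2 ^ k ≥ n / δ ^ 2` gives `(1 - δ) ^ m ≤ exp (-m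
    -- δ) ≤ 1 / (m δ) ≤ δ / n`.
    · have h6 : (l.length : ℝ) / δ ^ 2 ≤ m := by
        refine (Nat.le_ceil _).trans (Nat.cast_le.2 ?_)
        exact (Nat.lt_two_pow_self).le.trans (by simpa using h5)
      have h7 : (l.length : ℝ) / δ ≤ m * δ := by
        rw [div_le_iff₀ (by positivity)] at h6 ⊢
        linarith
      refine (hlog m).trans ?_
      rw [Real.exp_neg, ← inv_div]
      refine inv_anti₀ (by positivity) ?_
      linarith [Real.add_one_le_exp (m * δ)]
  · rcases h4 with rfl | ⟨i, rfl, h4⟩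
    · simp only [Nat.cast_one, le_add_iff_nonneg_right]
      positivity
    · have h6 := h4.trans_le (hlog i)
      rw [← inv_div, ← Real.exp_log (show 0 < (l.length : ℝ) / δ by positivity), ← Real.exp_neg,
        Real.exp_lt_exp] at h6
      have h7 : (i : ℝ) ≤ Real.log (l.length / δ) / δ := by
        rw [le_div_iff₀ hδ0]
        linarith
      push_cast
      rw [mul_div_assoc]
      linarith
  · have : ((allThresholds (δ / l.length) ⌈(l.length : ℝ) / δ ^ 2⌉₊ (1 - δ) E).time : ℝ) +
        (6 * l.length + 4) * 1 ≤ (6 * l.length + 4) * m + 2 := by exact_mod_cast h3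
    linarith

/-- The pieces of a run of the variant with thresholding. -/
theorem oneGuessGreedyPlusThreshold_eq (I : Inst V) {l : List V} {ε : ℝ} {r : ℝ × List (ℝ × V)}
    (hr : (firstThresholds I l).val = r) {L : Timed (List (ℝ × V))}
    (hL : allThresholds (ε / 16 / l.length) ⌈(l.length : ℝ) / (ε / 16) ^ 2⌉₊ (1 - ε / 16) r.2 = L) :
    (oneGuessGreedyPlusThreshold I l ε).val =
      (thresholdGuessLoop I l (ε / 16) r.1 L.val l (I.f ∅, [])).val.2 ∧
    (oneGuessGreedyPlusThreshold I l ε).time = l.length + (firstThresholds I l).time + L.time +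
      (thresholdGuessLoop I l (ε / 16) r.1 L.val l (I.f ∅, [])).time + 6 := by
  subst hr hL
  simp only [oneGuessGreedyPlusThreshold, op_bind, eval_bind, Timed.val_tick, Timed.time_tick,
    Timed.val_bind, Timed.time_bind, val_op, time_op, val_len, time_len, List.toFinset_nil,
    true_and]
  ring

theorem oneGuessGreedyPlusThreshold_isApprox {I : Inst V} (hI : I.IsBSM)
    (hne : I.ground.Nonempty) {l : List V} (hl : l.Nodup) (hlg : l.toFinset = I.ground) {ε : ℝ}
    (hε0 : 0 < ε) (hε1 : ε < 1) :
    I.IsApprox ((1 - ε) * ((3 - Real.log 4) / (4 - Real.log 4)))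
      (oneGuessGreedyPlusThreshold I l ε).val.toFinset := by
  have hmem : ∀ v, v ∈ l ↔ v ∈ I.ground := fun v => by rw [← hlg, List.mem_toFinset]
  have hcard : I.ground.card = l.length := by rw [← hlg, List.toFinset_card_of_nodup hl]
  have hl0 : l ≠ [] := by
    rintro rfl
    simp [← hlg] at hne
  obtain ⟨h1, h2, h3, h4⟩ := firstThresholds_spec I (ε / 16) l
  generalize hr : (firstThresholds I l).val = r at h1 h2 h3 h4
  obtain ⟨m, hm1, hE, hm, -, -⟩ := exists_allThresholds I hl0 (show 0 < ε / 16 by linarith)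
    (by linarith) h1
  generalize hL : allThresholds (ε / 16 / l.length) ⌈(l.length : ℝ) / (ε / 16) ^ 2⌉₊
    (1 - ε / 16) r.2 = L at hE
  rw [(oneGuessGreedyPlusThreshold_eq I hr hL).1, ratio_eq]
  have hEg : ∀ x ∈ L.val, x.2 ∈ I.ground := fun x hx => (hmem _).1 ((hE.mem_iff x).1 hx).1
  obtain ⟨⟨hval, hfeas⟩, hle0, hle⟩ := thresholdGuessLoop_spec hI (fun v hv => (hmem v).1 hv)
    (δ := ε / 16) (M := r.1) hEg (G := l) (fun v hv => (hmem v).1 hv) (b := (I.f ∅, []))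
    ⟨by simp, by simpa using hI.feasible_empty⟩
  have hsingle : ∀ y ∈ I.ground, I.f {y} ≤
      (thresholdGuessLoop I l (ε / 16) r.1 L.val l (I.f ∅, [])).val.1 := fun y hy =>
    (single_le_thresholdRecord I l _ _ _ y).trans (hle y ((hmem y).2 hy))
  rw [hval] at hle0 hle hsingle
  -- The largest singleton value is among the values the output dominates, so `M ≤ A` in the
  -- analysis.
  have hM : r.1 ≤ I.f (thresholdGuessLoop I l (ε / 16) r.1 L.val l (I.f ∅, [])).val.2.toFinset := by
    rcases h4 with h4 | ⟨v, hv, h4⟩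
    · exact h4.le.trans (hI.nonneg _ hfeas.1)
    · exact h4.le.trans (hsingle v ((hmem v).1 hv))
  refine hI.isApprox ?_ hfeas hle0 hsingle fun O y r' hO => ?_
  · nlinarith [gap_lt, gap_gt]
  · have := hO.ratio_le_thresholdRecord hI hmem (show 0 < ε / 16 by linarith) (by linarith) h2 hM
      hm1 (by rwa [hcard]) hE (hle y ((hmem y).2 (hO.sub hO.memy)))
    rwa [show 1 - 16 * (ε / 16) = 1 - ε by ring] at this

theorem time_oneGuessGreedyPlusThreshold_le {I : Inst V} (hI : I.IsBSM)
    (hne : I.ground.Nonempty) {l : List V} (hl : l.Nodup) (hlg : l.toFinset = I.ground) {ε : ℝ}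
    (hε0 : 0 < ε) (hε1 : ε < 1) :
    ((oneGuessGreedyPlusThreshold I l ε).time : ℝ) ≤
      4000 * ((I.ground.card : ℝ) ^ 2 / ε) * (1 + Real.log (I.ground.card / ε)) ^ 1 := by
  have hmem : ∀ v, v ∈ l ↔ v ∈ I.ground := fun v => by rw [← hlg, List.mem_toFinset]
  have hcard : I.ground.card = l.length := by rw [← hlg, List.toFinset_card_of_nodup hl]
  have hl0 : l ≠ [] := by
    rintro rfl
    simp [← hlg] at hne
  have hn1 : 1 ≤ (l.length : ℝ) := by exact_mod_cast List.length_pos_of_ne_nil hl0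
  obtain ⟨h1, h2, h3, -⟩ := firstThresholds_spec I (ε / 16) l
  generalize hr : (firstThresholds I l).val = r at h1 h2 h3
  obtain ⟨m, hm1, hE, -, hm, htE⟩ := exists_allThresholds I hl0 (show 0 < ε / 16 by linarith)
    (by linarith) h1
  generalize hL : allThresholds (ε / 16 / l.length) ⌈(l.length : ℝ) / (ε / 16) ^ 2⌉₊
    (1 - ε / 16) r.2 = L at hE htE
  rw [(oneGuessGreedyPlusThreshold_eq I hr hL).2, hcard, pow_one]
  have hEg : ∀ x ∈ L.val, x.2 ∈ I.ground := fun x hx => (hmem _).1 ((hE.mem_iff x).1 hx).1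
  have htF : ((firstThresholds I l).time : ℝ) ≤ (2 * l.length + 9) * l.length + 1 := by
    exact_mod_cast time_firstThresholds_le I l le_rfl
  have hElen : (L.val.length : ℝ) ≤ l.length * m := by exact_mod_cast hE.length_le
  set n : ℝ := (l.length : ℝ) with hn
  set Λ := Real.log (n / ε) with hΛ
  have hΛ0 : 0 ≤ Λ := Real.log_nonneg (by rw [one_le_div hε0]; linarith)
  set q := (1 + Λ) / ε with hq
  have hq1 : 1 ≤ q := by
    rw [hq, one_le_div hε0]
    linarith
  have hlog2 := Real.log_two_lt_d9
  -- `97 = 1 + 2 * 3 * 16`, where `log (16 n / ε) ≤ 3 (1 + Λ)`.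
  have hmq : (m : ℝ) ≤ 97 * q := by
    have e : n / (ε / 16) = 2 ^ 4 * (n / ε) := by
      field_simp
      norm_num
    have hlog : Real.log (n / (ε / 16)) ≤ 3 * (1 + Λ) := by
      rw [e, Real.log_mul (by positivity) (by positivity), Real.log_pow]
      push_cast
      linarith
    refine hm.trans ?_
    have h5 : 2 * Real.log (n / (ε / 16)) / (ε / 16) ≤ 2 * (3 * (1 + Λ)) / (ε / 16) := by
      gcongr
    have h6 : 2 * (3 * (1 + Λ)) / (ε / 16) = 96 * q := by
      rw [hq]
      field_simp
      ring
    linarith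
  -- `1871 = 14 * 97 + 8 * 64 + 1`: the pairs visited, the augmentation passes, and the end of the
  -- loop.
  have hrec : ∀ y ∈ l, ((thresholdRecord I l (ε / 16) r.1 L.val y).time : ℝ) ≤
      1871 * n * q := by
    intro y hy
    have hyg := (hmem y).1 hy
    rcases h2.lt_or_eq with hM | hM
    · have hy0 := hI.nonneg {y} (by simpa using hyg)
      have hyN : I.f {y} ≤ (n + 1) * r.1 := by
        have := h3 y hy
        nlinarith
      have h5 := time_thresholdLoop_le l (δ := ε / 16) (M := r.1) (N := (n + 1) * r.1)
        (by linarith) hM (fun S hS => by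
          have := hI.le_of_single_le (fun v hv => h3 v ((hmem v).2 hv)) hne hS
          rwa [hcard] at this) hI.nonneg hEg (S := [y]) (by simpa using hyg) (I.c y) (I.f {y})
        hy0 hyN (augment I [y] (I.c y) l (I.f {y}, [y])).val
      rw [← thresholdRecord, ← hn] at h5
      have h6 : Real.log (((n + 1) * r.1 + r.1) / (I.f {y} + r.1)) ≤ 2 * (1 + Λ) := by
        have h7 : ((n + 1) * r.1 + r.1) / (I.f {y} + r.1) ≤ 2 ^ 2 * (n / ε) := by
          rw [div_le_iff₀ (by positivity)]
          have h8 : n ≤ n / ε := by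
            rw [le_div_iff₀ hε0]
            nlinarith
          have h9 : (n + 1) * r.1 + r.1 ≤ 2 ^ 2 * n * r.1 := by nlinarith
          have h10 : 2 ^ 2 * n * r.1 ≤ 2 ^ 2 * (n / ε) * (I.f {y} + r.1) := by
            gcongr
            linarith
          linarith
        refine (Real.log_le_log (by positivity) h7).trans ?_
        rw [Real.log_mul (by positivity) (by positivity), Real.log_pow]
        push_cast
        linarith
      have h7 : ε / 32 ≤ Real.log (1 + ε / 16) := by
        refine le_trans ?_ (Real.one_sub_inv_le_log_of_pos (by positivity))
        have e : 1 - (1 + ε / 16)⁻¹ = ε / (16 + ε) := by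
          field_simp
          ring
        rw [e]
        exact div_le_div_of_nonneg_left hε0.le (by linarith) (by linarith)
      have h8 : Real.log (((n + 1) * r.1 + r.1) / (I.f {y} + r.1)) / Real.log (1 + ε / 16) ≤
          64 * q := by
        have h9 : 64 * q = 2 * (1 + Λ) / (ε / 32) := by
          rw [hq]
          field_simp
          ring
        rw [h9]
        exact div_le_div₀ (by linarith) h6 (by linarith) h7
      have h9 : (7 * n + 1) * (Real.log (((n + 1) * r.1 + r.1) / (I.f {y} + r.1)) /
          Real.log (1 + ε / 16)) ≤ (8 * n) * (64 * q) :=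
        mul_le_mul (by linarith) h8 (div_nonneg (Real.log_nonneg (by
          rw [one_le_div (by positivity)]
          linarith)) (by linarith)) (by linarith)
      have h10 : (L.val.length : ℝ) ≤ n * (97 * q) :=
        hElen.trans (mul_le_mul_of_nonneg_left hmq (by linarith))
      have h11 : 1 ≤ n * q := one_le_mul_of_one_le_of_one_le hn1 hq1
      linarith
    -- If all singletons have value zero, the logarithmic potential is unavailable, but there are no
    -- pairs to visit.
    · have hnil : L.val = [] := List.eq_nil_iff_forall_not_mem.2 fun x hx => by
        obtain ⟨hx1, hx2, -⟩ := (hE.mem_iff x).1 hx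
        have := h3 _ hx1
        linarith
      have h11 : 1 ≤ n * q := one_le_mul_of_one_le_of_one_le hn1 hq1
      simp only [thresholdRecord, hnil, thresholdLoop, time_op, Nat.cast_one]
      linarith
  have htG := time_thresholdGuessLoop_le I l (ε / 16) r.1 L.val l (I.f ∅, [])
    (by positivity) hrec
  have hgoal : 4000 * (n ^ 2 / ε) * (1 + Λ) = 4000 * (n ^ 2 * q) := by
    rw [hq]
    ring
  rw [hgoal]
  have hnn : n ≤ n ^ 2 := by nlinarith
  have hn2q : n ^ 2 ≤ n ^ 2 * q := le_mul_of_one_le_right (by positivity) hq1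
  have hnq : n * q ≤ n ^ 2 * q := mul_le_mul_of_nonneg_right hnn (by linarith)
  have hall : (6 * n + 4) * (m : ℝ) ≤ (10 * n) * (97 * q) :=
    mul_le_mul (by linarith) hmq (Nat.cast_nonneg _) (by linarith)
  have htG' : n * (7 * n + 6 + 1871 * n * q) + 1 = 7 * n ^ 2 + 6 * n + 1871 * (n ^ 2 * q) + 1 := by
    ring
  rw [← hn, htG'] at htG
  have htF' : (2 * n + 9) * n + 1 = 2 * n ^ 2 + 9 * n + 1 := by ring
  push_cast
  linarith

end BSM

/-! ### The theorem -/

theorem theorem2 :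
    -- the approximation ratio of 1-Guess Greedy⁺, however ties are broken
    (∀ (V : Type) [DecidableEq V] (I : BSM.Inst V), I.IsBSM →
      ∀ T ∈ BSM.guess 1 BSM.greedyPlus I,
        I.IsApprox ((3 - Real.log 4) / (4 - Real.log 4)) T) ∧
    ((3 - Real.log 4) / (4 - Real.log 4) > (0.6174 : ℝ) ∧
      (0.6174 : ℝ) > 0.9767 * (1 - 1 / Real.exp 1)) ∧
    -- its implementation in cubic time
    (∃ C : ℕ, ∀ (V : Type) [DecidableEq V] (I : BSM.Inst V), I.IsBSM → I.ground.Nonempty →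
      ∀ l : List V, l.Nodup → l.toFinset = I.ground →
        (BSM.oneGuessGreedyPlus I l).val.toFinset ∈ BSM.guess 1 BSM.greedyPlus I ∧
        (BSM.oneGuessGreedyPlus I l).time ≤ C * I.ground.card ^ 3) ∧
    -- the variant with thresholding
    (∃ (C : ℝ) (k : ℕ), ∀ (V : Type) [DecidableEq V] (I : BSM.Inst V), I.IsBSM →
      I.ground.Nonempty → ∀ l : List V, l.Nodup → l.toFinset = I.ground →
      ∀ ε : ℝ, 0 < ε → ε < 1 →
        I.IsApprox ((1 - ε) * ((3 - Real.log 4) / (4 - Real.log 4)))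
          (BSM.oneGuessGreedyPlusThreshold I l ε).val.toFinset ∧
        ((BSM.oneGuessGreedyPlusThreshold I l ε).time : ℝ) ≤
          C * ((I.ground.card : ℝ) ^ 2 / ε) * (1 + Real.log (I.ground.card / ε)) ^ k) := by
  refine ⟨fun V _ I hI T hT => BSM.isApprox_of_mem_guess_greedyPlus hI hT, BSM.ratio_bounds,
    ⟨51, fun V _ I hI hne l hl hlg => ⟨BSM.oneGuessGreedyPlus_mem hI hl hlg, ?_⟩⟩,
    4000, 1, fun V _ I hI hne l hl hlg ε hε0 hε1 =>
      ⟨BSM.oneGuessGreedyPlusThreshold_isApprox hI hne hl hlg hε0 hε1,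
        BSM.time_oneGuessGreedyPlusThreshold_le hI hne hl hlg hε0 hε1⟩⟩
  rw [← hlg, List.toFinset_card_of_nodup hl]
  refine BSM.time_oneGuessGreedyPlus_le I l ?_
  rintro rfl
  simp [← hlg] at hne
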